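/- Let $\mathcal X\subseteq\mathbb R^d$ be compact and convex, let $(\Delta,\mathbb P)$ be a probability space, let $f:\mathcal X\to\mathbb R$ be convex, and let $g_1,\dots,g_M:\mathcal X\times\Delta\to\mathbb R$ ($M\ge 1$) be measurable functions that are convex in the first argument. For finite sets $\Delta_1,\dots,\Delta_M\subseteq\Delta$ let $\mathrm{SCP}[\Delta_1,\dots,\Delta_M]$ be the program $$\min_{x\in\mathcal X} f(x)\quad\text{s.t.}\quad g_i(x,\delta)\le 0\ \text{ for all }\delta\in\Delta_i,\ i=1,\dots,M .$$ Assume that, for every finite nonempty set of scenarios and all subsets $\Delta_1,\dots,\Delta_M$ that together cover it, $\mathrm{SCP}[\Delta_1,\dots,\Delta_M]$ is feasible, its feasible region has nonempty interior, and it has a unique minimizer. For each $i$ let $V_i\subseteq\mathbb R^d$ be a linear subspace such that $g_i(x,\delta)$ depends on $x\in\mathcal X$ only through the orthogonal projection of $x$ onto $V_i$ (for instance, $V_i$ is spanned by the coordinate vectors of the decision variables that enter $g_i$). Let $\mathcal X_i$ be the projection of $\mathcal X$ onto $V_i$, and let $d_i$ be the dimension of the smallest linear subspace that contains $\mathcal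 X_i$. For $\varepsilon',\beta'\in(0,1)$ and $k\in\mathbb N$ put $$S(\varepsilon',\beta',k)=\min\Big\{N\in\mathbb N:\ \sum_{j=0}^{k-1}\binom Nj\varepsilon'^j(1-\varepsilon')^{N-j}\le\beta'\Big\}.$$ Fix $\varepsilon,\beta\in(0,1)$ and $\varepsilon_i,\beta_i\in(0,1)$ with $\sum_{i=1}^M\varepsilon_i=\varepsilon$ and $\sum_{i=1}^M\beta_i=\beta$, and integers $S_i\ge S(\varepsilon_i,\beta_i,d_i)$. Draw $S=\sum_{i=1}^M S_i$ i.i.d. samples $\delta^1,\dots,\delta^S$ from $\mathbb P$. Fix index sets $J_1,\dots,J_M$ with $|J_i|=S_i$ and $\bigcup_i J_i=\{1,\dots,S\}$ (chosen independently of the sample values), and let $\Delta_i=\{\delta^j: j\in J_i\}$. Let $x^*=x^*[\Delta_1,\dots,\Delta_M]$ be the minimizer of $\mathrm{SCP}[\Delta_1,\dots,\Delta_M]$, assumed to be a measurable function of the samples. With $g(x,\delta)=\max_{i=1,\dots,M}g_i(x,\delta)$, $$\mathbb P^S\Big[\ \mathbb P\big[g(x^*[\Delta_1,\dots,\Delta_M],\delta)>0\big]\le\varepsilon\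 \Big]\ \ge\ 1-\beta .$$ -/

import Mathlib

open MeasureTheory

namespace ScenarioProgram

/-- The decision space `ℝ^d` with its Euclidean structure. -/
abbrev Dec (d : ℕ) : Type := EuclideanSpace ℝ (Fin d)

/-- Feasible region of `SCP[D₁, …, D_M]`: the points `x ∈ X` with `g i x δ ≤ 0` for all `δ ∈ D i`
and all `i`. The constraint functions matter only on `X`. -/
def feasibleSet {d M : ℕ} {Δ : Type*} (X : Set (Dec d)) (g : Fin M → Dec d → Δ → ℝ)
    (D : Fin M → Set Δ) : Set (Dec d) :=
  {x | x ∈ X ∧ ∀ i, ∀ δ ∈ D i, g i x δ ≤ 0}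

/-- `x` is a minimizer of `SCP[D₁, …, D_M]`. -/
def IsMinimizer {d M : ℕ} {Δ : Type*} (X : Set (Dec d)) (f : Dec d → ℝ)
    (g : Fin M → Dec d → Δ → ℝ) (D : Fin M → Set Δ) (x : Dec d) : Prop :=
  x ∈ feasibleSet X g D ∧ ∀ y ∈ feasibleSet X g D, f x ≤ f y

/-- The standing assumption: for every finite nonempty list of scenarios and every collection of
subsets `D₁, …, D_M` of it that together cover it, the scenario program is feasible, its feasible
region has nonempty interior, and it has exactly one minimizer. (Feasibility is implied by
nonempty interior; it is listed to match the usual wording.) -/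
def FeasibleUnique {d M : ℕ} {Δ : Type*} (X : Set (Dec d)) (f : Dec d → ℝ)
    (g : Fin M → Dec d → Δ → ℝ) : Prop :=
  ∀ (S : ℕ), 0 < S → ∀ (δ : Fin S → Δ) (D : Fin M → Set Δ),
    (∀ i, D i ⊆ Set.range δ) → (∀ j, ∃ i, δ j ∈ D i) →
      (feasibleSet X g D).Nonempty ∧ (interior (feasibleSet X g D)).Nonempty ∧
        ∃! x, IsMinimizer X f g D x

/-- The function `h` on `X × Δ` depends on `x` only through the orthogonal projection of `x`
onto the subspace `V`. If `V` is spanned by some of the coordinate vectors, this says that `h`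
depends only on the corresponding decision variables. -/
def DependsOnlyOn {d : ℕ} {Δ : Type*} (X : Set (Dec d)) (V : Submodule ℝ (Dec d))
    (h : Dec d → Δ → ℝ) : Prop :=
  ∀ x ∈ X, ∀ y ∈ X, V.starProjection x = V.starProjection y → ∀ δ, h x δ = h y δ

/-- The domain of a constraint that depends only on the part of `x` in `V`: the projection of `X`
onto `V`. -/
def constraintDomain {d : ℕ} (X : Set (Dec d)) (V : Submodule ℝ (Dec d)) : Set (Dec d) :=
  (fun x => V.starProjection x) '' X

/-- The dimension of a set: that of the smallest linear subspace containing it. -/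
noncomputable def setDim {d : ℕ} (A : Set (Dec d)) : ℕ :=
  Module.finrank ℝ (Submodule.span ℝ A)

/-- The sample size `S(ε, β, k)`: the least `N` with
`∑_{j=0}^{k-1} (N choose j) ε^j (1-ε)^(N-j) ≤ β`. -/
noncomputable def sampleSize (ε β : ℝ) (k : ℕ) : ℕ :=
  sInf {N : ℕ | ∑ j ∈ Finset.range k, (N.choose j : ℝ) * ε ^ j * (1 - ε) ^ (N - j) ≤ β}

/-- The joint constraint function `g(x, δ) = max_i g_i(x, δ)`. -/
noncomputable def jointConstraint {d M : ℕ} [NeZero M] {Δ : Type*} (g : Fin M → Dec d → Δ → ℝ)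
    (x : Dec d) (δ : Δ) : ℝ :=
  Finset.univ.sup' Finset.univ_nonempty (fun i => g i x δ)

/-- The chance constraint `P[h(x, δ) > 0] ≤ ε`. -/
def ChanceConstraint {d : ℕ} {Δ : Type*} [MeasurableSpace Δ] (P : Measure Δ)
    (h : Dec d → Δ → ℝ) (ε : ℝ) (x : Dec d) : Prop :=
  P {δ | 0 < h x δ} ≤ ENNReal.ofReal ε

end ScenarioProgram

/-! By a union bound over the constraints, it suffices that each `g i` alone is violated with
probability more than `εs i` only on an event of measure at most `βs i`. The sets `J i` are
disjoint, so conditioning on the samples outside `J i` freezes all other constraints inside a convex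
domain. What remains is a scenario program with one constraint function and `S i` samples, whose
bound must hold with the dimension `k` of the span of the projected domain.

For one constraint function, the optimal value is treated as a function on finite sets of
constraints. It is monotone, Helly's theorem in the span gives bases of size at most `k`, and strict
convexity with a Slater ball gives locality. If no value has two bases, exactly one `k`-subset of
any `n ≥ k` sample points is such that all other points pass a test relative to it: they leave the
value unchanged, and labels break ties when the basis is smaller than `k`. If `U` is the conditional
probability of passing given a `k`-sample, counting gives `(n choose k) * E[U ^ (n - k)] = 1` for
every `n ≥ k`. These moments identify `U` as a beta variable. Violation above `ε` forces `U ≤ 1 - ε`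
for the selected subset, and the same count restricted to that event is exactly the binomial tail.

Degeneracy is removed by perturbation: each scenario gets an independent uniform label `t`, its
constraint becomes `h x δ < ρ * exp t`, and `ρ * ‖x‖ ^ 2` is added to the cost. The bound holds for
each `ρ > 0` and passes to `ρ → 0`, because unique minimizers make a violated scenario raise the
original value strictly. -/

namespace ScenarioProgram

/-! ### Binomial tails and the sample size. -/

/-- The lower binomial tail `∑_{j<k} (N choose j) ε^j (1-ε)^(N-j)`. -/
noncomputable def binomialTail (N : ℕ) (ε : ℝ) (k : ℕ) : ℝ :=
  ∑ j ∈ Finset.range k, (N.choose j : ℝ) * ε ^ j * (1 - ε) ^ (N - j)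

/-- Pascal's rule, that is, conditioning on one of the `N + 1` trials. -/
theorem binomialTail_succ (N : ℕ) (ε : ℝ) (k : ℕ) :
    binomialTail (N + 1) ε (k + 1) =
      (1 - ε) * binomialTail N ε (k + 1) + ε * binomialTail N ε k := by
  unfold binomialTail
  induction k with
  | zero => simp [pow_succ, mul_comm]
  | succ k ih =>
    have key : ((N + 1).choose (k + 1) : ℝ) * ε ^ (k + 1) * (1 - ε) ^ (N + 1 - (k + 1)) =
        (1 - ε) * ((N.choose (k + 1) : ℝ) * ε ^ (k + 1) * (1 - ε) ^ (N - (k + 1))) +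
          ε * ((N.choose k : ℝ) * ε ^ k * (1 - ε) ^ (N - k)) := by
      rw [Nat.choose_succ_succ, Nat.add_sub_add_right]
      rcases Nat.lt_or_ge k N with h | h
      · obtain ⟨m, rfl⟩ : ∃ m, N = k + 1 + m := ⟨N - (k + 1), by omega⟩
        rw [show k + 1 + m - k = m + 1 by omega, show k + 1 + m - (k + 1) = m by omega]
        push_cast
        ring
      -- The truncated exponent `N - (k + 1)` is harmless here because its coefficient vanishes.
      · rw [Nat.choose_eq_zero_of_lt (by omega : N < k + 1)]
        push_cast
        ring
    rw [Finset.sum_range_succ _ (k + 1), Finset.sum_range_succ _ (k + 1), key, ih]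
    rw [Finset.sum_range_succ (fun j => (N.choose j : ℝ) * ε ^ j * (1 - ε) ^ (N - j)) k]
    ring

theorem binomialTail_mono_right (N : ℕ) {ε : ℝ} (h0 : 0 ≤ ε) (h1 : ε ≤ 1) :
    Monotone (binomialTail N ε) := by
  have : 0 ≤ 1 - ε := by linarith
  refine monotone_nat_of_le_succ fun k => ?_
  unfold binomialTail
  rw [Finset.sum_range_succ]
  have : 0 ≤ (N.choose k : ℝ) * ε ^ k * (1 - ε) ^ (N - k) := by positivity
  linarith

theorem binomialTail_antitone {ε : ℝ} (h0 : 0 ≤ ε) (h1 : ε ≤ 1) (k : ℕ) :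
    Antitone fun N => binomialTail N ε k := by
  refine antitone_nat_of_succ_le fun N => ?_
  rcases k with _ | k
  · simp [binomialTail]
  · rw [binomialTail_succ]
    nlinarith [binomialTail_mono_right N h0 h1 (Nat.le_succ k)]

/-- Exponential decay beats the polynomial growth of `N.choose j`. This makes the set in
`sampleSize` nonempty, so that its `sInf` is a genuine minimum and not the default value `0`. -/
theorem tendsto_binomialTail {ε : ℝ} (h0 : 0 < ε) (h1 : ε < 1) (k : ℕ) :
    Filter.Tendsto (fun N => binomialTail N ε k) Filter.atTop (nhds 0) := by
  have : ∀ j ∈ Finset.range k, Filter.Tendsto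
      (fun N : ℕ => (N.choose j : ℝ) * ε ^ j * (1 - ε) ^ (N - j)) Filter.atTop (nhds 0) := by
    intro j _
    have hr : 0 < 1 - ε := by linarith
    have ht := (tendsto_pow_const_mul_const_pow_of_abs_lt_one j
      (r := 1 - ε) (by rw [abs_of_pos hr]; linarith)).const_mul (ε ^ j / (1 - ε) ^ j)
    rw [mul_zero] at ht
    refine squeeze_zero' (Filter.Eventually.of_forall fun N => by positivity) ?_ ht
    filter_upwards [Filter.eventually_ge_atTop j] with N hN
    have hc : (N.choose j : ℝ) ≤ (N : ℝ) ^ j := by exact_mod_cast Nat.choose_le_pow N j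
    have hp : (1 - ε) ^ (N - j) = (1 - ε) ^ N / (1 - ε) ^ j := by
      rw [eq_div_iff (by positivity), ← pow_add, Nat.sub_add_cancel hN]
    rw [hp]
    calc (N.choose j : ℝ) * ε ^ j * ((1 - ε) ^ N / (1 - ε) ^ j)
        ≤ (N : ℝ) ^ j * ε ^ j * ((1 - ε) ^ N / (1 - ε) ^ j) := by gcongr
      _ = _ := by ring
  simpa [binomialTail] using tendsto_finsetSum _ this

theorem binomialTail_le_of_sampleSize_le {ε β : ℝ} (hε : ε ∈ Set.Ioo (0 : ℝ) 1) (hβ : 0 < β)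
    {k N : ℕ} (h : sampleSize ε β k ≤ N) : binomialTail N ε k ≤ β := by
  have hne : {N : ℕ | ∑ j ∈ Finset.range k,
      (N.choose j : ℝ) * ε ^ j * (1 - ε) ^ (N - j) ≤ β}.Nonempty :=
    ((tendsto_binomialTail hε.1 hε.2 k).eventually (ge_mem_nhds hβ)).exists
  exact (binomialTail_antitone hε.1.le hε.2.le k h).trans (Nat.sInf_mem hne)

theorem binomialTail_eq_one (ε : ℝ) {N k : ℕ} (h : N < k) : binomialTail N ε k = 1 := by
  have h1 : binomialTail N ε (N + 1) = 1 := by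
    have := add_pow ε (1 - ε) N
    rw [add_sub_cancel, one_pow] at this
    rw [this]
    exact Finset.sum_congr rfl fun j _ => by ring
  rw [← h1]
  symm
  refine Finset.sum_subset (Finset.range_mono h) fun j _ hj => ?_
  rw [Nat.choose_eq_zero_of_lt (by simpa using hj)]
  simp

/-- With fewer than `k` trials the tail is the whole binomial sum, which is `1`; a confidence level
below `1` therefore forces at least `k` samples. -/
theorem le_of_binomialTail_lt_one {ε : ℝ} {N k : ℕ} (h : binomialTail N ε k < 1) : k ≤ N := by
  by_contra! hk
  exact h.ne (binomialTail_eq_one ε hk)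

/-! ### Beta integrals and the moment problem on the unit interval. -/

/-- The derivatives of consecutive terms telescope, leaving only the contribution of the last one.
-/
theorem hasDerivAt_binomialTail (N k : ℕ) (hk : k + 1 ≤ N) (x : ℝ) :
    HasDerivAt (fun x => binomialTail N x (k + 1))
      (-((N.choose (k + 1) : ℝ) * (k + 1) * x ^ k * (1 - x) ^ (N - (k + 1)))) x := by
  unfold binomialTail
  induction k with
  | zero =>
    simp only [zero_add, Finset.range_one, Finset.sum_singleton]
    have := ((hasDerivAt_id x).const_sub 1).pow N
    simp only [Nat.choose_zero_right, Nat.cast_one, pow_zero, mul_one, one_mul, Nat.sub_zero,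
      Nat.choose_one_right, Nat.cast_zero, zero_add]
    refine (HasDerivAt.congr_deriv (f := fun x => (1 - x) ^ N) this ?_)
    simp
  | succ k ih =>
    have hsum := (ih (by omega)).add
      ((((hasDerivAt_id x).pow (k + 1)).const_mul (N.choose (k + 1) : ℝ)).mul
        (((hasDerivAt_id x).const_sub 1).pow (N - (k + 1))))
    have hc : (N.choose (k + 2) : ℝ) * (k + 2) = N.choose (k + 1) * ((N - (k + 1) : ℕ) : ℝ) := by
      exact_mod_cast Nat.choose_succ_right_eq N (k + 1)
    have hf : (fun x => ∑ j ∈ Finset.range (k + 1 + 1), (N.choose j : ℝ) * x ^ j *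
        (1 - x) ^ (N - j)) = (fun x => ∑ j ∈ Finset.range (k + 1), (N.choose j : ℝ) * x ^ j *
        (1 - x) ^ (N - j)) + (fun y => (N.choose (k + 1) : ℝ) * (id ^ (k + 1)) y) *
        (fun x => 1 - id x) ^ (N - (k + 1)) := by
      ext y
      rw [Finset.sum_range_succ]
      rfl
    rw [hf]
    refine hsum.congr_deriv ?_
    have : N - (k + 1) - 1 = N - (k + 1 + 1) := by omega
    rw [this]
    simp only [id, Nat.add_sub_cancel, mul_one, Pi.pow_apply]
    push_cast
    have e : ((k : ℝ) + 1 + 1) = k + 2 := by ring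
    rw [e, hc]
    ring

/-- The binomial tail as an incomplete beta integral. -/
theorem integral_beta_eq_binomialTail (N k : ℕ) (hk : k + 1 ≤ N) (s : ℝ) :
    ∫ u in (0 : ℝ)..s, (N.choose (k + 1) : ℝ) * (k + 1) * (1 - u) ^ k * u ^ (N - (k + 1)) =
      binomialTail N (1 - s) (k + 1) := by
  have hd : ∀ u ∈ Set.uIcc 0 s, HasDerivAt (fun u => binomialTail N (1 - u) (k + 1))
      ((N.choose (k + 1) : ℝ) * (k + 1) * (1 - u) ^ k * u ^ (N - (k + 1))) u := by
    intro u _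
    have := (hasDerivAt_binomialTail N k hk (1 - u)).comp u ((hasDerivAt_id u).const_sub 1)
    refine HasDerivAt.congr_deriv (f := fun u => binomialTail N (1 - u) (k + 1)) this ?_
    ring
  rw [intervalIntegral.integral_eq_sub_of_hasDerivAt hd
    (Continuous.intervalIntegrable (by fun_prop) _ _)]
  have : binomialTail N (1 - 0) (k + 1) = 0 := by
    unfold binomialTail
    refine Finset.sum_eq_zero fun j hj => ?_
    have : N - j ≠ 0 := by have := Finset.mem_range.1 hj; omega
    simp [this]
  rw [this, sub_zero]

theorem integrable_pow_of_Icc {ν : Measure ℝ} [IsFiniteMeasure ν]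
    (hν : ∀ᵐ u ∂ν, u ∈ Set.Icc (0 : ℝ) 1) (m : ℕ) : Integrable (fun u => u ^ m) ν := by
  refine Integrable.of_bound (by fun_prop) 1 ?_
  filter_upwards [hν] with u hu
  rw [Real.norm_eq_abs, abs_of_nonneg (pow_nonneg hu.1 m)]
  exact pow_le_one₀ hu.1 hu.2

/-- A finite measure on the unit interval is determined by its moments. -/
theorem ext_of_moments {μ ν : Measure ℝ} [IsFiniteMeasure μ] [IsFiniteMeasure ν]
    (hμ : ∀ᵐ u ∂μ, u ∈ Set.Icc (0 : ℝ) 1) (hν : ∀ᵐ u ∂ν, u ∈ Set.Icc (0 : ℝ) 1)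
    (h : ∀ m : ℕ, ∫ u, u ^ m ∂μ = ∫ u, u ^ m ∂ν) : μ = ν := by
  refine ext_of_forall_integral_eq_of_IsFiniteMeasure fun f => ?_
  have hpi : ∀ {κ : Measure ℝ} [IsFiniteMeasure κ], (∀ᵐ u ∂κ, u ∈ Set.Icc (0 : ℝ) 1) →
      ∀ p : Polynomial ℝ, Integrable (fun u => p.eval u) κ ∧
        ∫ u, p.eval u ∂κ = ∑ i ∈ Finset.range (p.natDegree + 1), p.coeff i * ∫ u, u ^ i ∂κ := by
    intro κ _ hκ p
    simp_rw [Polynomial.eval_eq_sum_range]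
    have hi : ∀ i ∈ Finset.range (p.natDegree + 1),
        Integrable (fun u => p.coeff i * u ^ i) κ :=
      fun i _ => (integrable_pow_of_Icc hκ i).const_mul _
    refine ⟨integrable_finsetSum _ hi, ?_⟩
    rw [integral_finsetSum _ hi]
    exact Finset.sum_congr rfl fun i _ => integral_const_mul _ _
  have hpe : ∀ p : Polynomial ℝ, ∫ u, p.eval u ∂μ = ∫ u, p.eval u ∂ν := by
    intro p
    rw [(hpi (κ := μ) hμ p).2, (hpi (κ := ν) hν p).2]
    exact Finset.sum_congr rfl fun i _ => by rw [h]
  have hclose : ∀ {κ : Measure ℝ} [IsFiniteMeasure κ], (∀ᵐ u ∂κ, u ∈ Set.Icc (0 : ℝ) 1) →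
      ∀ (p : Polynomial ℝ) (η : ℝ), (∀ x ∈ Set.Icc (0 : ℝ) 1, |p.eval x - f x| < η) →
        |∫ u, f u ∂κ - ∫ u, p.eval u ∂κ| ≤ η * κ.real Set.univ := by
    intro κ _ hκ p η hp
    rw [← integral_sub (f.integrable κ) (hpi (κ := κ) hκ p).1]
    rw [← Real.norm_eq_abs]
    refine norm_integral_le_of_norm_le_const (μ := κ) ?_
    filter_upwards [hκ] with u hu
    rw [Real.norm_eq_abs, abs_sub_comm]
    exact (hp u hu).le
  set C := μ.real Set.univ + ν.real Set.univ + 1 with hC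
  have hCpos : 0 < C := by positivity
  refine eq_of_forall_dist_le fun η hη => ?_
  -- Weierstrass approximation; the tolerance is divided by `C`, which exceeds the sum of the two
  -- total masses.
  obtain ⟨p, hp⟩ := exists_polynomial_near_of_continuousOn 0 1 f f.continuous.continuousOn
    (η / C) (by positivity)
  have h1 := hclose (κ := μ) hμ p _ hp
  have h2 := hclose (κ := ν) hν p _ hp
  rw [hpe p] at h1
  rw [Real.dist_eq]
  have h3 := abs_sub_le (∫ u, f u ∂μ) (∫ u, p.eval u ∂ν) (∫ u, f u ∂ν)
  rw [abs_sub_comm (∫ u, p.eval u ∂ν)] at h3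
  calc _ ≤ η / C * μ.real Set.univ + η / C * ν.real Set.univ := by linarith
    _ ≤ η / C * C := by
        rw [← mul_add]
        gcongr
        linarith
    _ = η := by field_simp

/-- The law with density `(k+1)(1-u)^k` on `[0,1]`: the minimum of `k + 1` uniform variables. -/
noncomputable def betaMeasure (k : ℕ) : Measure ℝ :=
  (volume.restrict (Set.Icc 0 1)).withDensity
    fun u => ENNReal.ofReal (((k : ℝ) + 1) * (1 - u) ^ k)

theorem setIntegral_betaMeasure (k m : ℕ) {s : ℝ} (h0 : 0 ≤ s) (h1 : s ≤ 1) :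
    ∫ u in Set.Iic s, u ^ m ∂(betaMeasure k) =
      ∫ u in (0 : ℝ)..s, ((k : ℝ) + 1) * (1 - u) ^ k * u ^ m := by
  unfold betaMeasure
  rw [restrict_withDensity measurableSet_Iic, Measure.restrict_restrict measurableSet_Iic,
    integral_withDensity_eq_integral_toReal_smul (by fun_prop) (by simp)]
  have : Set.Iic s ∩ Set.Icc 0 1 = Set.Icc 0 s := by
    ext x
    simp only [Set.mem_inter_iff, Set.mem_Iic, Set.mem_Icc]
    constructor
    · rintro ⟨h, h', _⟩; exact ⟨h', h⟩
    · rintro ⟨h, h'⟩; exact ⟨h', h, h'.trans h1⟩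
  rw [this, intervalIntegral.integral_of_le h0, ← integral_Icc_eq_integral_Ioc]
  refine setIntegral_congr_fun measurableSet_Icc fun u hu => ?_
  have : 0 ≤ 1 - u := by linarith [hu.2]
  simp only [smul_eq_mul]
  rw [ENNReal.toReal_ofReal (by positivity)]

theorem ae_betaMeasure (k : ℕ) : ∀ᵐ u ∂(betaMeasure k), u ∈ Set.Icc (0 : ℝ) 1 :=
  (withDensity_absolutelyContinuous _ _).ae_le (ae_restrict_mem measurableSet_Icc)

instance (k : ℕ) : IsFiniteMeasure (betaMeasure k) := by
  unfold betaMeasure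
  refine isFiniteMeasure_withDensity_ofReal (Integrable.hasFiniteIntegral ?_)
  exact (Continuous.continuousOn (by fun_prop)).integrableOn_Icc

theorem integral_betaMeasure (k m : ℕ) :
    ∫ u, u ^ m ∂(betaMeasure k) = ∫ u in Set.Iic 1, u ^ m ∂(betaMeasure k) := by
  rw [Measure.restrict_eq_self_of_ae_mem]
  filter_upwards [ae_betaMeasure k] with u hu using hu.2

theorem choose_mul_setIntegral_betaMeasure (k N : ℕ) (hN : k + 1 ≤ N) {s : ℝ}
    (h0 : 0 ≤ s) (h1 : s ≤ 1) :
    (N.choose (k + 1) : ℝ) * ∫ u in Set.Iic s, u ^ (N - (k + 1)) ∂(betaMeasure k) =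
      binomialTail N (1 - s) (k + 1) := by
  rw [setIntegral_betaMeasure k _ h0 h1, ← intervalIntegral.integral_const_mul,
    ← integral_beta_eq_binomialTail N k hN]
  congr 1
  ext u
  ring

/-- A law on `[0,1]` whose moments are `(n choose k+1)⁻¹` has binomial partial moments. -/
theorem choose_mul_setIntegral_eq_binomialTail {ν : Measure ℝ} [IsFiniteMeasure ν] {k : ℕ}
    (hν : ∀ᵐ u ∂ν, u ∈ Set.Icc (0 : ℝ) 1)
    (hmom : ∀ n, k + 1 ≤ n → (n.choose (k + 1) : ℝ) * ∫ u, u ^ (n - (k + 1)) ∂ν = 1)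
    {N : ℕ} (hN : k + 1 ≤ N) {s : ℝ} (h0 : 0 ≤ s) (h1 : s ≤ 1) :
    (N.choose (k + 1) : ℝ) * ∫ u in Set.Iic s, u ^ (N - (k + 1)) ∂ν =
      binomialTail N (1 - s) (k + 1) := by
  have : ν = betaMeasure k := by
    refine ext_of_moments hν (ae_betaMeasure k) fun m => ?_
    have e1 := hmom (m + (k + 1)) (by omega)
    have e2 := choose_mul_setIntegral_betaMeasure k (m + (k + 1)) (by omega) zero_le_one le_rfl
    rw [← integral_betaMeasure, sub_self] at e2
    have e3 : binomialTail (m + (k + 1)) 0 (k + 1) = 1 := by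
      unfold binomialTail
      rw [Finset.sum_range_succ']
      simp
    rw [e3, ← e1, Nat.add_sub_cancel] at e2
    refine (mul_left_cancel₀ ?_ e2).symm
    exact_mod_cast (Nat.choose_pos (by omega : k + 1 ≤ m + (k + 1))).ne'
  rw [this]
  exact choose_mul_setIntegral_betaMeasure k N hN h0 h1

/-! ### LP-type problems: selecting a unique subsample. -/

/-- Given a finite set `B` and injective labels there is exactly one `k`-element superset of `B`
that is completed by the elements of smallest label. -/
theorem existsUnique_lowest_superset {ι : Type*} [Fintype ι] [DecidableEq ι] (B : Finset ι)
    {t : ι → ℝ} (ht : Function.Injective t) {k : ℕ} (hB : B.card ≤ k) (hk : k ≤ Fintype.card ι) :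
    ∃! I : Finset ι, B ⊆ I ∧ I.card = k ∧ ∀ i ∈ I, i ∉ B → ∀ j ∉ I, t i < t j := by
  obtain ⟨I₀, hBI₀, -, hI₀⟩ := Finset.exists_subsuperset_card_eq (Finset.subset_univ B) hB
    (by simpa using hk)
  -- Minimizing the sum of the labels makes the lowest completion accessible to an exchange
  -- argument, both for existence and for uniqueness.
  obtain ⟨I, hI, hmin⟩ := Finset.exists_min_image
    (Finset.univ.filter fun I : Finset ι => B ⊆ I ∧ I.card = k) (fun I => ∑ i ∈ I, t i)
    ⟨I₀, by simp [hBI₀, hI₀]⟩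
  simp only [Finset.mem_filter, Finset.mem_univ, true_and] at hI hmin
  refine ⟨I, ⟨hI.1, hI.2, fun i hi hiB j hj => ?_⟩, ?_⟩
  · by_contra! hle
    have hij : i ≠ j := fun h => hj (h ▸ hi)
    have hlt : t j < t i := lt_of_le_of_ne hle fun h => hij (ht h).symm
    have hj' : j ∉ I.erase i := fun h => hj (Finset.mem_of_mem_erase h)
    have := hmin (insert j (I.erase i)) ⟨fun b hb => Finset.mem_insert_of_mem
      (Finset.mem_erase.2 ⟨fun h => hiB (h ▸ hb), hI.1 hb⟩), by
        rw [Finset.card_insert_of_notMem hj', Finset.card_erase_add_one hi, hI.2]⟩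
    rw [Finset.sum_insert hj', ← Finset.add_sum_erase I t hi] at this
    linarith
  · rintro K ⟨hBK, hK, hlow⟩
    by_contra hne
    have h1 : ¬ K ⊆ I := fun h => hne (Finset.eq_of_subset_of_card_le h (by omega))
    have h2 : ¬ I ⊆ K := fun h => hne (Finset.eq_of_subset_of_card_le h (by omega)).symm
    obtain ⟨a, ha, haI⟩ := Finset.not_subset.1 h1
    obtain ⟨b, hb, hbK⟩ := Finset.not_subset.1 h2
    have hab := hlow a ha (fun h => haI (hI.1 h)) b hbK
    have hj' : a ∉ I.erase b := fun h => haI (Finset.mem_of_mem_erase h)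
    have hbB : b ∉ B := fun h => hbK (hBK h)
    have := hmin (insert a (I.erase b)) ⟨fun c hc => Finset.mem_insert_of_mem
      (Finset.mem_erase.2 ⟨fun h => hbB (h ▸ hc), hI.1 hc⟩), by
        rw [Finset.card_insert_of_notMem hj', Finset.card_erase_add_one hb, hI.2]⟩
    rw [Finset.sum_insert hj', ← Finset.add_sum_erase I t hb] at this
    linarith

section Core

variable {Ω : Type*}

/-- The axioms of an LP-type problem of combinatorial dimension at most `k`, for a value
function on finite sets of constraints. -/
structure IsLPType (k : ℕ) (v : Set Ω → ℝ) : Prop where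
  mono : ∀ A B : Set Ω, B.Finite → A ⊆ B → v A ≤ v B
  basis : ∀ A : Set Ω, A.Finite → ∃ B ⊆ A, B.ncard ≤ k ∧ v B = v A
  locality : ∀ A S : Set Ω, A.Finite → S.Finite → (∀ e ∈ S, v (insert e A) = v A) →
    v (A ∪ S) = v A

/-- The constraint `e` does not alter the value on `A`, nor does it come before a constraint of
`A` that is not needed for this value, in the order given by the labels `τ`. -/
def Compatible (v : Set Ω → ℝ) (τ : Ω → ℝ) (A : Set Ω) (e : Ω) : Prop :=
  v (insert e A) = v A ∧ ∀ a ∈ A, v {b ∈ A | τ b ≠ τ a} = v A → τ a < τ e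

/-- The labels of the sample are distinct and no value is attained by two different bases. -/
def Nondegenerate (v : Set Ω → ℝ) (τ : Ω → ℝ) {n : ℕ} (ω : Fin n → Ω) : Prop :=
  Function.Injective (τ ∘ ω) ∧ ∀ B₁ B₂ : Finset (Fin n), ∀ j ∈ B₁, j ∉ B₂ →
    v (ω '' B₁) = v (ω '' B₂) → v (ω '' (B₁.erase j)) = v (ω '' B₁)

/-- Nondegeneracy yields one basis `B` contained in every subsample that attains the full value. By
locality a compatible set attains that value, so it contains `B`; the label test then says that its
other members are those of lowest label. -/
theorem IsLPType.existsUnique_compatible {k n : ℕ} {v : Set Ω → ℝ} (hv : IsLPType k v)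
    {τ : Ω → ℝ} {ω : Fin n → Ω} (hω : Nondegenerate v τ ω) (hk : k ≤ n) :
    ∃! I : Finset (Fin n), I.card = k ∧ ∀ j ∉ I, Compatible v τ (ω '' I) (ω j) := by
  classical
  have hinj : Function.Injective ω := hω.1.of_comp
  set w : Finset (Fin n) → ℝ := fun I => v (ω '' I) with hw
  have hmono : ∀ I K : Finset (Fin n), I ⊆ K → w I ≤ w K := fun I K h =>
    hv.mono _ _ (Set.toFinite _) (Set.image_mono (by exact_mod_cast h))
  set m := w Finset.univ with hm
  obtain ⟨B₀, hB₀, hB₀k, hB₀v⟩ := hv.basis (ω '' (Finset.univ : Finset (Fin n))) (Set.toFinite _)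
  obtain ⟨I₀, hI₀⟩ : ∃ I₀ : Finset (Fin n), ω '' I₀ = B₀ := by
    obtain ⟨s, -, hs⟩ := Set.subset_image_iff.1 hB₀
    exact ⟨s.toFinset, by simpa using hs⟩
  have hI₀k : I₀.card ≤ k := by
    rw [← hI₀, Set.ncard_image_of_injective _ hinj, Set.ncard_coe_finset] at hB₀k
    exact hB₀k
  have hI₀m : w I₀ = m := by rw [hw, hm]; simp only [hI₀]; exact hB₀v
  obtain ⟨B, hB, hBmin⟩ := Finset.exists_min_image
    (Finset.univ.filter fun I : Finset (Fin n) => w I = m) Finset.card ⟨I₀, by simp [hI₀m]⟩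
  simp only [Finset.mem_filter, Finset.mem_univ, true_and] at hB hBmin
  have hBk : B.card ≤ k := (hBmin I₀ hI₀m).trans hI₀k
  have hgood : ∀ I, w I = m ↔ B ⊆ I := by
    intro I
    constructor
    · intro hI j hj
      by_contra hjI
      -- If `I` missed some `j ∈ B`, nondegeneracy would make `j` redundant in `B`, against minimal
      -- cardinality.
      have h1 : w (B.erase j) = w B := hω.2 B I j hj hjI (hB.trans hI.symm)
      have h2 := hBmin (B.erase j) (h1.trans hB)
      have h3 := Finset.card_erase_lt_of_mem hj
      omega
    · intro hI
      exact le_antisymm (hmono _ _ (Finset.subset_univ _)) (hB ▸ hmono _ _ hI)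
  have hiff : ∀ I : Finset (Fin n), (I.card = k ∧ ∀ j ∉ I, Compatible v τ (ω '' I) (ω j)) ↔
      (B ⊆ I ∧ I.card = k ∧ ∀ i ∈ I, i ∉ B → ∀ j ∉ I, τ (ω i) < τ (ω j)) := by
    intro I
    have hthin : ∀ i, {b ∈ ω '' (I : Set (Fin n)) | τ b ≠ τ (ω i)} =
        ω '' ((I.erase i : Finset (Fin n)) : Set (Fin n)) := by
      intro i
      ext b
      constructor
      · rintro ⟨⟨l, hl, rfl⟩, hne⟩
        refine ⟨l, ?_, rfl⟩
        simp only [Finset.coe_erase]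
        exact ⟨hl, fun h => hne (by rw [Set.mem_singleton_iff.1 h])⟩
      · rintro ⟨l, hl, rfl⟩
        simp only [Finset.coe_erase] at hl
        exact ⟨⟨l, hl.1, rfl⟩, fun h => hl.2 (hω.1 h)⟩
    have hins : ∀ j, insert (ω j) (ω '' (I : Set (Fin n))) =
        ω '' ((insert j I : Finset (Fin n)) : Set (Fin n)) := by
      intro j
      rw [Finset.coe_insert, Set.image_insert_eq]
    constructor
    · rintro ⟨hcard, hI⟩
      have hIm : w I = m := by
        have := hv.locality (ω '' I) (ω '' (Finset.univ : Finset (Fin n))) (Set.toFinite _)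
          (Set.toFinite _) (by
            rintro _ ⟨j, -, rfl⟩
            by_cases hj : j ∈ I
            · rw [Set.insert_eq_of_mem (Set.mem_image_of_mem ω (Finset.mem_coe.2 hj))]
            · exact (hI j hj).1)
        rw [← Set.image_union] at this
        simp only [Finset.coe_univ, Set.union_univ] at this
        simp only [hw, hm, Finset.coe_univ]
        exact this.symm
      refine ⟨(hgood I).1 hIm, hcard, fun i hi hiB j hj => ?_⟩
      refine (hI j hj).2 (ω i) ⟨i, hi, rfl⟩ ?_
      rw [hthin]
      refine ((hgood (I.erase i)).2 fun b hb => ?_).trans hIm.symm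
      exact Finset.mem_erase.2 ⟨fun h => hiB (h ▸ hb), (hgood I).1 hIm hb⟩
    · rintro ⟨hBI, hcard, hlow⟩
      have hIm := (hgood I).2 hBI
      refine ⟨hcard, fun j hj => ⟨?_, ?_⟩⟩
      · rw [hins]
        exact ((hgood (insert j I)).2 (hBI.trans (Finset.subset_insert _ _))).trans hIm.symm
      · rintro _ ⟨i, hi, rfl⟩ hval
        refine hlow i hi (fun hiB => ?_) j hj
        rw [hthin] at hval
        have := (hgood (I.erase i)).1 (hval.trans hIm)
        exact Finset.notMem_erase i I (this hiB)
  simp_rw [hiff]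
  exact existsUnique_lowest_superset B hω.1 hBk (by simpa using hk)

variable [MeasurableSpace Ω] (Q : Measure Ω) [IsProbabilityMeasure Q]

/-- The thinned set in `Compatible` varies with the point, so one splits according to which of the
finitely many index sets `J` it is the image of. -/
theorem measurableSet_compatible {v : Set Ω → ℝ} {τ : Ω → ℝ} (hτ : Measurable τ)
    (hmeas : ∀ (n : ℕ) (I : Finset (Fin n)), Measurable fun ω : Fin n → Ω => v (ω '' I))
    (k : ℕ) : MeasurableSet {p : (Fin k → Ω) × Ω | Compatible v τ (Set.range p.1) p.2} := by
  classical
  have hset : {p : (Fin k → Ω) × Ω | Compatible v τ (Set.range p.1) p.2} =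
      {p : (Fin k → Ω) × Ω | v ((Fin.cons p.2 p.1 : Fin (k + 1) → Ω) '' (Finset.univ : Finset (Fin (k + 1)))) =
          v (p.1 '' (Finset.univ : Finset (Fin k))) ∧
        ∀ (i : Fin k) (J : Finset (Fin k)), (∀ l, l ∈ J ↔ τ (p.1 l) ≠ τ (p.1 i)) →
          v (p.1 '' J) = v (p.1 '' (Finset.univ : Finset (Fin k))) → τ (p.1 i) < τ p.2} := by
    ext ⟨w, e⟩
    simp only [Set.mem_ofPred_eq, Compatible, Finset.coe_univ, Set.image_univ, Fin.range_cons,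
      Set.forall_mem_range]
    refine and_congr_right fun _ => forall_congr' fun i => ?_
    have hJ : ∀ J : Finset (Fin k), (∀ l, l ∈ J ↔ τ (w l) ≠ τ (w i)) →
        {b ∈ Set.range w | τ b ≠ τ (w i)} = w '' J := by
      intro J hJ
      ext b
      constructor
      · rintro ⟨⟨l, rfl⟩, h⟩
        exact ⟨l, (hJ l).2 h, rfl⟩
      · rintro ⟨l, hl, rfl⟩
        exact ⟨⟨l, rfl⟩, (hJ l).1 hl⟩
    constructor
    · intro h J hJ' hval
      exact h (by rw [hJ J hJ']; exact hval)
    · intro h hval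
      have h' : ∀ l, l ∈ Finset.univ.filter (fun l => τ (w l) ≠ τ (w i)) ↔
          τ (w l) ≠ τ (w i) := by simp
      refine h _ h' ?_
      rw [← hJ _ h']
      exact hval
  rw [hset]
  have hcons : Measurable fun p : (Fin k → Ω) × Ω => (Fin.cons p.2 p.1 : Fin (k + 1) → Ω) := by
    refine measurable_pi_iff.2 fun i => ?_
    refine Fin.cases ?_ (fun i => ?_) i
    · simpa using measurable_snd
    · simp only [Fin.cons_succ]
      exact (measurable_pi_apply i).comp measurable_fst
  have hv : ∀ J : Finset (Fin k), Measurable fun p : (Fin k → Ω) × Ω => v (p.1 '' J) :=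
    fun J => (hmeas k J).comp measurable_fst
  have ht : ∀ i : Fin k, Measurable fun p : (Fin k → Ω) × Ω => τ (p.1 i) :=
    fun i => hτ.comp ((measurable_pi_apply i).comp measurable_fst)
  have ht' : Measurable fun p : (Fin k → Ω) × Ω => τ p.2 := hτ.comp measurable_snd
  refine MeasurableSet.inter
    (measurableSet_eq_fun ((hmeas (k + 1) Finset.univ).comp hcons) (hv _)) ?_
  suffices h : MeasurableSet {p : (Fin k → Ω) × Ω | ∀ (i : Fin k) (J : Finset (Fin k)),
      (∀ l, l ∈ J ↔ τ (p.1 l) ≠ τ (p.1 i)) →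
        v (p.1 '' J) = v (p.1 '' (Finset.univ : Finset (Fin k))) → τ (p.1 i) < τ p.2} from h
  simp only [Set.ofPred_forall]
  refine MeasurableSet.iInter fun i => MeasurableSet.iInter fun J => ?_
  have h1 : MeasurableSet {p : (Fin k → Ω) × Ω | ∀ l, l ∈ J ↔ τ (p.1 l) ≠ τ (p.1 i)} := by
    simp only [Set.ofPred_forall]
    refine MeasurableSet.iInter fun l => ?_
    by_cases hl : l ∈ J
    · simp only [hl, true_iff]
      exact (measurableSet_eq_fun (ht l) (ht i)).compl
    · simpa only [hl, false_iff, not_not, ne_eq] using measurableSet_eq_fun (ht l) (ht i)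
  have h2 : MeasurableSet {p : (Fin k → Ω) × Ω |
      v (p.1 '' J) = v (p.1 '' (Finset.univ : Finset (Fin k)))} := measurableSet_eq_fun (hv _) (hv _)
  have h3 : MeasurableSet {p : (Fin k → Ω) × Ω | τ (p.1 i) < τ p.2} :=
    measurableSet_lt (ht i) ht'
  exact h1.imp (h2.imp h3)

end Core

/-! ### The binomial bound for random LP-type problems. -/

section CoreBound

variable {Ω : Type*} [MeasurableSpace Ω] (Q : Measure Ω) [IsProbabilityMeasure Q]

theorem measurableSet_forall_notMem {n k : ℕ} (I : Finset (Fin n)) (hI : I.card = k)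
    {G : Set Ω → Ω → Prop}
    (hG : MeasurableSet {p : (Fin k → Ω) × Ω | G (Set.range p.1) p.2}) :
    MeasurableSet {ω : Fin n → Ω | ∀ j ∉ I, G (ω '' I) (ω j)} := by
  simp only [Set.ofPred_forall]
  refine MeasurableSet.iInter fun j => MeasurableSet.iInter fun _ => ?_
  have hm : Measurable fun ω : Fin n → Ω => ((fun i => ω (I.orderEmbOfFin hI i) : Fin k → Ω), ω j) :=
    (measurable_pi_iff.2 fun i => measurable_pi_apply _).prodMk (measurable_pi_apply j)
  have := hm hG
  convert this using 1
  ext ω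
  have : Set.range (fun i => ω (I.orderEmbOfFin hI i)) = ω '' I := by
    rw [← Finset.range_orderEmbOfFin I hI, ← Set.range_comp]
    rfl
  simp only [Set.mem_preimage, Set.mem_ofPred_eq, this]

/-- A sample splits into the subsample indexed by `I` and the remaining points. -/
theorem exists_splitEquiv {n k : ℕ} (I : Finset (Fin n)) (hI : I.card = k) :
    ∃ Φ : (Fin k → Ω) × ({j // j ∉ I} → Ω) ≃ᵐ (Fin n → Ω),
      MeasurePreserving Φ
        ((Measure.pi fun _ : Fin k => Q).prod (Measure.pi fun _ : {j // j ∉ I} => Q))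
        (Measure.pi fun _ : Fin n => Q) ∧
      (∀ p i, Φ p (I.orderIsoOfFin hI i) = p.1 i) ∧ ∀ p (j : {j // j ∉ I}), Φ p j = p.2 j := by
  classical
  let σ : Fin k ⊕ {j // j ∉ I} ≃ Fin n :=
    (Equiv.sumCongr (I.orderIsoOfFin hI).toEquiv (Equiv.refl _)).trans
      (Equiv.sumCompl fun j => j ∈ I)
  let Φ := (MeasurableEquiv.sumPiEquivProdPi fun _ : Fin k ⊕ {j // j ∉ I} => Ω).symm.trans
    (MeasurableEquiv.piCongrLeft (fun _ : Fin n => Ω) σ)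
  have hΦ : MeasurePreserving Φ
      ((Measure.pi fun _ : Fin k => Q).prod (Measure.pi fun _ : {j // j ∉ I} => Q))
      (Measure.pi fun _ : Fin n => Q) :=
    (measurePreserving_piCongrLeft (fun _ : Fin n => Q) σ).comp
      (measurePreserving_sumPiEquivProdPi_symm fun _ : Fin k ⊕ {j // j ∉ I} => Q)
  have hσ : ∀ p s, Φ p (σ s) = Sum.elim p.1 p.2 s := by
    intro p s
    change (Equiv.piCongrLeft (fun _ : Fin n => Ω) σ)
      ((Equiv.sumPiEquivProdPi fun _ : Fin k ⊕ {j // j ∉ I} => Ω).symm p) (σ s) = _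
    rw [Equiv.piCongrLeft_apply_apply]
    cases s <;> rfl
  exact ⟨Φ, hΦ, fun p i => hσ p (Sum.inl i), fun p j => hσ p (Sum.inr j)⟩

/-- The probability that the subsample indexed by `I` has the property `B` and that all other
sample points pass the test `G` relative to it. -/
theorem pi_measure_subsample {n k : ℕ} (I : Finset (Fin n)) (hI : I.card = k)
    {G : Set Ω → Ω → Prop}
    (hG : MeasurableSet {p : (Fin k → Ω) × Ω | G (Set.range p.1) p.2})
    {B : Set (Set Ω)} (hB : MeasurableSet {w : Fin k → Ω | Set.range w ∈ B}) :
    Measure.pi (fun _ : Fin n => Q) {ω | ω '' I ∈ B ∧ ∀ j ∉ I, G (ω '' I) (ω j)} =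
      ∫⁻ w in {w : Fin k → Ω | Set.range w ∈ B}, Q {e | G (Set.range w) e} ^ (n - k)
        ∂(Measure.pi fun _ : Fin k => Q) := by
  classical
  obtain ⟨Φ, hΦ, hinl, hinr⟩ := exists_splitEquiv Q I hI
  have himg : ∀ p, Φ p '' I = Set.range p.1 := by
    intro p
    ext e
    constructor
    · rintro ⟨j, hj, rfl⟩
      refine ⟨(I.orderIsoOfFin hI).symm ⟨j, hj⟩, ?_⟩
      rw [← hinl]
      simp
    · rintro ⟨i, rfl⟩
      exact ⟨I.orderIsoOfFin hI i, (I.orderIsoOfFin hI i).2, hinl p i⟩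
  rw [← hΦ.measure_preimage_equiv]
  have hset : Φ ⁻¹' {ω | ω '' I ∈ B ∧ ∀ j ∉ I, G (ω '' I) (ω j)} =
      {p : (Fin k → Ω) × ({j // j ∉ I} → Ω) | Set.range p.1 ∈ B ∧
        ∀ j, G (Set.range p.1) (p.2 j)} := by
    ext p
    simp only [Set.mem_preimage, Set.mem_ofPred_eq, himg]
    refine and_congr_right fun _ => ⟨fun h j => ?_, fun h j hj => ?_⟩
    · rw [← hinr]; exact h j j.2
    · have := h ⟨j, hj⟩
      rw [← hinr] at this
      exact this
  have hmeas : MeasurableSet {p : (Fin k → Ω) × ({j // j ∉ I} → Ω) | Set.range p.1 ∈ B ∧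
        ∀ j, G (Set.range p.1) (p.2 j)} := by
    refine MeasurableSet.inter (measurable_fst hB) ?_
    suffices h : MeasurableSet {p : (Fin k → Ω) × ({j // j ∉ I} → Ω) |
        ∀ j, G (Set.range p.1) (p.2 j)} from h
    simp only [Set.ofPred_forall]
    refine MeasurableSet.iInter fun j => ?_
    have hm : Measurable fun p : (Fin k → Ω) × ({j // j ∉ I} → Ω) => (p.1, p.2 j) :=
      measurable_fst.prodMk ((measurable_pi_apply j).comp measurable_snd)
    exact hm hG
  rw [hset, Measure.prod_apply hmeas, ← lintegral_indicator hB]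
  refine lintegral_congr fun w => ?_
  by_cases hw : w ∈ {w : Fin k → Ω | Set.range w ∈ B}
  · rw [Set.indicator_of_mem hw]
    have : Prod.mk w ⁻¹' {p : (Fin k → Ω) × ({j // j ∉ I} → Ω) | Set.range p.1 ∈ B ∧
        ∀ j, G (Set.range p.1) (p.2 j)} = Set.univ.pi fun _ => {e | G (Set.range w) e} := by
      ext z
      simp only [Set.mem_preimage, Set.mem_ofPred_eq, Set.mem_pi, Set.mem_univ, true_imp_iff]
      exact and_iff_right hw
    rw [this, Measure.pi_pi, Finset.prod_const, Finset.card_univ, Fintype.card_subtype_compl,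
      Fintype.card_fin, Fintype.card_coe, hI]
  · rw [Set.indicator_of_notMem hw]
    have : Prod.mk w ⁻¹' {p : (Fin k → Ω) × ({j // j ∉ I} → Ω) | Set.range p.1 ∈ B ∧
        ∀ j, G (Set.range p.1) (p.2 j)} = ∅ := by
      ext z
      simp only [Set.mem_preimage, Set.mem_ofPred_eq, Set.mem_empty_iff_false, iff_false]
      exact fun h => hw h.1
    rw [this, measure_empty]

/-- The binomial bound on the probability that a new constraint alters the value by more than
`ε`, for almost surely nondegenerate LP-type problems. -/
theorem IsLPType.measure_violation_le {k : ℕ} {v : Set Ω → ℝ} (hv : IsLPType (k + 1) v)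
    {τ : Ω → ℝ} (hτ : Measurable τ)
    (hmeas : ∀ (n : ℕ) (I : Finset (Fin n)), Measurable fun ω : Fin n → Ω => v (ω '' I))
    (hnd : ∀ n : ℕ, ∀ᵐ ω ∂(Measure.pi fun _ : Fin n => Q), Nondegenerate v τ ω)
    {N : ℕ} (hN : k + 1 ≤ N) {ε : ℝ} (h0 : 0 ≤ ε) (h1 : ε ≤ 1) :
    Measure.pi (fun _ : Fin N => Q)
        {ω | ENNReal.ofReal ε < Q {e | v (Set.range ω) < v (insert e (Set.range ω))}} ≤
      ENNReal.ofReal (binomialTail N ε (k + 1)) := by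
  classical
  set G := Compatible v τ with hGdef
  have hG : MeasurableSet {p : (Fin (k + 1) → Ω) × Ω | G (Set.range p.1) p.2} :=
    measurableSet_compatible hτ hmeas (k + 1)
  have hGs : ∀ w : Fin (k + 1) → Ω, MeasurableSet {e | G (Set.range w) e} := fun w =>
    measurable_prodMk_left hG
  set U : (Fin (k + 1) → Ω) → ENNReal := fun w => Q {e | G (Set.range w) e} with hU
  have hUm : Measurable U := measurable_measure_prodMk_left hG
  have hU1 : ∀ w, U w ≤ 1 := fun w => prob_le_one
  set ν := (Measure.pi fun _ : Fin (k + 1) => Q).map fun w => (U w).toReal with hν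
  have : IsProbabilityMeasure ν := Measure.isProbabilityMeasure_map hUm.ennreal_toReal.aemeasurable
  have hνI : ∀ᵐ u ∂ν, u ∈ Set.Icc (0 : ℝ) 1 := by
    refine (ae_map_iff hUm.ennreal_toReal.aemeasurable measurableSet_Icc).2 ?_
    refine Filter.Eventually.of_forall fun w => ⟨ENNReal.toReal_nonneg, ?_⟩
    exact ENNReal.toReal_le_of_le_ofReal zero_le_one (by simpa using hU1 w)
  have hset : ∀ s : ℝ, 0 ≤ s →
      {w | U w ≤ ENNReal.ofReal s} = (fun w => (U w).toReal) ⁻¹' Set.Iic s := by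
    intro s hs
    ext w
    exact ENNReal.le_ofReal_iff_toReal_le ((hU1 w).trans_lt ENNReal.one_lt_top).ne hs
  have hlint : ∀ (m : ℕ) (s : ℝ), 0 ≤ s →
      ∫⁻ w in {w | U w ≤ ENNReal.ofReal s}, U w ^ m ∂(Measure.pi fun _ : Fin (k + 1) => Q) =
        ENNReal.ofReal (∫ u in Set.Iic s, u ^ m ∂ν) := by
    intro m s hs
    rw [hset s hs, ofReal_integral_eq_lintegral_ofReal
      ((integrable_pow_of_Icc hνI m).restrict) (ae_restrict_of_ae (by
        filter_upwards [hνI] with u hu using pow_nonneg hu.1 m)), hν,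
      Measure.restrict_map hUm.ennreal_toReal measurableSet_Iic,
      lintegral_map (by fun_prop) hUm.ennreal_toReal]
    refine lintegral_congr fun w => ?_
    rw [ENNReal.ofReal_pow ENNReal.toReal_nonneg,
      ENNReal.ofReal_toReal ((hU1 w).trans_lt ENNReal.one_lt_top).ne]
  have hcard : ∀ n, (Finset.powersetCard (k + 1) (Finset.univ : Finset (Fin n))).card =
      n.choose (k + 1) := fun n => by simp
  -- The expected number of compatible `(k + 1)`-subsets of an `n`-sample is `1`. By exchangeability
  -- each of them contributes the same moment of `U`.
  have hmom : ∀ n, k + 1 ≤ n → (n.choose (k + 1) : ℝ) * ∫ u, u ^ (n - (k + 1)) ∂ν = 1 := by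
    intro n hn
    have hE : ∀ I ∈ Finset.powersetCard (k + 1) (Finset.univ : Finset (Fin n)),
        Measure.pi (fun _ : Fin n => Q) {ω | ∀ j ∉ I, G (ω '' I) (ω j)} =
          ENNReal.ofReal (∫ u, u ^ (n - (k + 1)) ∂ν) := by
      intro I hI
      have h := pi_measure_subsample Q I (Finset.mem_powersetCard.1 hI).2 hG (B := Set.univ)
        (by simp)
      have h' := hlint (n - (k + 1)) 1 zero_le_one
      have hu : {w | U w ≤ ENNReal.ofReal 1} = Set.univ := by
        ext w; simpa using hU1 w
      have hu' : ∫ u in Set.Iic 1, u ^ (n - (k + 1)) ∂ν = ∫ u, u ^ (n - (k + 1)) ∂ν := by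
        rw [Measure.restrict_eq_self_of_ae_mem]
        filter_upwards [hνI] with u hu using hu.2
      rw [hu, hu'] at h'
      simp only [Set.mem_univ, true_and, Set.ofPred_true] at h
      exact h.trans h'
    have hone : ∑ I ∈ Finset.powersetCard (k + 1) (Finset.univ : Finset (Fin n)),
        Measure.pi (fun _ : Fin n => Q) {ω | ∀ j ∉ I, G (ω '' I) (ω j)} = 1 := by
      have hm : ∀ I ∈ Finset.powersetCard (k + 1) (Finset.univ : Finset (Fin n)),
          MeasurableSet {ω : Fin n → Ω | ∀ j ∉ I, G (ω '' I) (ω j)} := fun I hI =>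
        measurableSet_forall_notMem I (Finset.mem_powersetCard.1 hI).2 hG
      rw [Finset.sum_congr rfl fun I hI => (lintegral_indicator_one (hm I hI)).symm,
        ← lintegral_finsetSum' _ fun I hI =>
          ((measurable_one.indicator (hm I hI)).aemeasurable)]
      rw [lintegral_congr_ae (g := fun _ => 1), lintegral_const, measure_univ, one_mul]
      filter_upwards [hnd n] with ω hω
      obtain ⟨I, hI, huniq⟩ := hv.existsUnique_compatible hω hn
      rw [Finset.sum_eq_single I]
      · exact Set.indicator_of_mem (s := {ω : Fin n → Ω | ∀ j ∉ I, G (ω '' I) (ω j)}) hI.2 _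
      · intro K hK hne
        refine Set.indicator_of_notMem (fun h => hne ?_) _
        exact huniq K ⟨(Finset.mem_powersetCard.1 hK).2, h⟩
      · intro h
        exact absurd (Finset.mem_powersetCard.2 ⟨Finset.subset_univ _, hI.1⟩) h
    rw [Finset.sum_congr rfl hE, Finset.sum_const, hcard, nsmul_eq_mul,
      ← ENNReal.ofReal_natCast, ← ENNReal.ofReal_mul (Nat.cast_nonneg _),
      ENNReal.ofReal_eq_one] at hone
    exact hone
  set B : Set (Set Ω) := {A | Q {e | G A e} ≤ ENNReal.ofReal (1 - ε)} with hB
  have hBm : MeasurableSet {w : Fin (k + 1) → Ω | Set.range w ∈ B} :=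
    measurableSet_le hUm measurable_const
  have hsub : ∀ᵐ ω ∂(Measure.pi fun _ : Fin N => Q),
      ω ∈ {ω : Fin N → Ω | ENNReal.ofReal ε <
        Q {e | v (Set.range ω) < v (insert e (Set.range ω))}} →
      ω ∈ ⋃ I ∈ Finset.powersetCard (k + 1) (Finset.univ : Finset (Fin N)),
        {ω : Fin N → Ω | ω '' I ∈ B ∧ ∀ j ∉ I, G (ω '' I) (ω j)} := by
    filter_upwards [hnd N] with ω hω hlt
    obtain ⟨I, ⟨hIc, hIG⟩, -⟩ := hv.existsUnique_compatible hω hN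
    simp only [Set.mem_iUnion]
    refine ⟨I, Finset.mem_powersetCard.2 ⟨Finset.subset_univ _, hIc⟩, ?_, hIG⟩
    have hrange : ω '' I = Set.range (fun i => ω (I.orderEmbOfFin hIc i)) := by
      rw [← Finset.range_orderEmbOfFin I hIc, ← Set.range_comp]
      rfl
    have hGm : MeasurableSet {e | G (ω '' I) e} := by rw [hrange]; exact hGs _
    have hval : ∀ e ∈ Set.range ω, v (insert e (ω '' I)) = v (ω '' I) := by
      rintro _ ⟨j, rfl⟩
      by_cases hj : j ∈ I
      · rw [Set.insert_eq_of_mem (Set.mem_image_of_mem ω (Finset.mem_coe.2 hj))]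
      · exact (hIG j hj).1
    have hrg : v (Set.range ω) = v (ω '' I) := by
      rw [← hv.locality _ _ (Set.toFinite _) (Set.finite_range ω) hval,
        Set.union_eq_self_of_subset_left (Set.image_subset_range _ _)]
    -- A compatible `e` cannot raise the value of the sample: locality from `ω '' I` absorbs the
    -- whole sample together with `e`.
    have hle : Q {e | v (Set.range ω) < v (insert e (Set.range ω))} ≤
        Q {e | G (ω '' I) e}ᶜ := by
      refine measure_mono fun e he hcomp => ?_
      have := hv.locality (ω '' I) (insert e (Set.range ω)) (Set.toFinite _)
        ((Set.finite_range ω).insert e) (by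
          rintro x (rfl | hx)
          · exact hcomp.1
          · exact hval x hx)
      rw [Set.union_eq_self_of_subset_left
        ((Set.image_subset_range _ _).trans (Set.subset_insert _ _))] at this
      have he' : v (Set.range ω) < v (insert e (Set.range ω)) := he
      rw [this, hrg] at he'
      exact lt_irrefl _ he'
    have hlt' := lt_of_lt_of_le hlt hle
    rw [prob_compl_eq_one_sub hGm] at hlt'
    change Q {e | G (ω '' I) e} ≤ ENNReal.ofReal (1 - ε)
    rw [ENNReal.ofReal_sub _ h0, ENNReal.ofReal_one]
    refine ENNReal.le_sub_of_add_le_left ENNReal.ofReal_ne_top ?_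
    have := (lt_tsub_iff_right.1 hlt').le
    exact this
  refine (measure_mono_ae hsub).trans ?_
  refine (measure_biUnion_finset_le _ _).trans ?_
  have hterm : ∀ I ∈ Finset.powersetCard (k + 1) (Finset.univ : Finset (Fin N)),
      Measure.pi (fun _ : Fin N => Q) {ω | ω '' I ∈ B ∧ ∀ j ∉ I, G (ω '' I) (ω j)} =
        ENNReal.ofReal (∫ u in Set.Iic (1 - ε), u ^ (N - (k + 1)) ∂ν) := by
    intro I hI
    rw [pi_measure_subsample Q I (Finset.mem_powersetCard.1 hI).2 hG hBm]
    exact hlint _ _ (by linarith)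
  rw [Finset.sum_congr rfl hterm, Finset.sum_const, hcard, nsmul_eq_mul,
    ← ENNReal.ofReal_natCast, ← ENNReal.ofReal_mul (Nat.cast_nonneg _),
    choose_mul_setIntegral_eq_binomialTail hνI hmom hN (by linarith) (by linarith),
    sub_sub_cancel]

end CoreBound

/-! ### Relaxed convex programs as LP-type problems. -/

/-- A convex program over a bounded set with a family of convex constraints `h x δ ≤ 0`, any
finitely many of which have a common feasible region with nonempty interior. -/
structure ConvexScenario (d : ℕ) (Δ : Type*) where
  Y : Set (Dec d)
  f : Dec d → ℝ
  h : Dec d → Δ → ℝ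
  convexOn_f : ConvexOn ℝ Y f
  convexOn_h : ∀ δ, ConvexOn ℝ Y fun x => h x δ
  f_nonneg : ∀ x, 0 ≤ f x
  isBounded : Bornology.IsBounded Y
  slater : ∀ D : Set Δ, D.Finite → (interior {x | x ∈ Y ∧ ∀ δ ∈ D, h x δ ≤ 0}).Nonempty

namespace ConvexScenario

variable {d : ℕ} {Δ : Type*} (p : ConvexScenario d Δ)

/-- The feasible region of the relaxed constraints `h x δ < ρ exp t`. -/
def relaxedFeasible (ρ : ℝ) (A : Set (Δ × ℝ)) : Set (Dec d) :=
  {x | x ∈ p.Y ∧ ∀ e ∈ A, p.h x e.1 < ρ * Real.exp e.2}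

/-- The regularized objective. -/
noncomputable def cost (ρ : ℝ) (x : Dec d) : ℝ := p.f x + ρ * ‖x‖ ^ 2

/-- The optimal value of the relaxed and regularized program. -/
noncomputable def value (ρ : ℝ) (A : Set (Δ × ℝ)) : ℝ :=
  sInf (p.cost ρ '' p.relaxedFeasible ρ A)

variable {p} {ρ : ℝ}

theorem cost_nonneg (hρ : 0 < ρ) (x : Dec d) : 0 ≤ p.cost ρ x :=
  add_nonneg (p.f_nonneg x) (by positivity)

theorem convexOn_cost (hρ : 0 < ρ) : ConvexOn ℝ p.Y (p.cost ρ) := by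
  have h1 : ConvexOn ℝ p.Y fun x : Dec d => ‖x‖ ^ 2 :=
    (convexOn_norm p.convexOn_f.1).pow (fun _ _ => norm_nonneg _) 2
  exact p.convexOn_f.add (h1.smul hρ.le)

/-- The parallelogram law turns the regularizing term into quantitative strict convexity, so
near-minimizers over a convex set are close to each other. -/
theorem cost_midpoint_le (x y : Dec d) (hx : x ∈ p.Y) (hy : y ∈ p.Y) :
    p.cost ρ ((1 / 2 : ℝ) • x + (1 / 2 : ℝ) • y) + ρ / 4 * ‖x - y‖ ^ 2 ≤
      (p.cost ρ x + p.cost ρ y) / 2 := by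
  have h1 := p.convexOn_f.2 hx hy (by norm_num : (0 : ℝ) ≤ 1 / 2) (by norm_num : (0 : ℝ) ≤ 1 / 2)
    (by norm_num)
  have h2 := parallelogram_law_with_norm ℝ x y
  have h3 : ‖(1 / 2 : ℝ) • x + (1 / 2 : ℝ) • y‖ = 1 / 2 * ‖x + y‖ := by
    rw [← smul_add, norm_smul]; norm_num
  simp only [smul_eq_mul] at h1
  unfold cost
  rw [h3]
  linear_combination h1 + ρ / 4 * h2

/-- Finitely many constraints have a common ball of feasible points. -/
theorem exists_ball_feasible {A : Set (Δ × ℝ)} (hA : A.Finite) :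
    ∃ (c : Dec d) (r : ℝ), 0 < r ∧
      ∀ x ∈ Metric.ball c r, x ∈ p.Y ∧ ∀ e ∈ A, p.h x e.1 ≤ 0 := by
  obtain ⟨c, hc⟩ := p.slater (Prod.fst '' A) (hA.image _)
  obtain ⟨r, hr, hball⟩ := Metric.isOpen_iff.1 isOpen_interior c hc
  refine ⟨c, r, hr, fun x hx => ?_⟩
  have := interior_subset (hball hx)
  exact ⟨this.1, fun e he => this.2 e.1 ⟨e, he, rfl⟩⟩

theorem exists_mem_interior_feasible {A : Set (Δ × ℝ)} (hA : A.Finite) :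
    ∃ c ∈ interior p.Y, ∀ e ∈ A, p.h c e.1 ≤ 0 := by
  obtain ⟨c, r, hr, hc⟩ := p.exists_ball_feasible hA
  exact ⟨c, mem_interior.2 ⟨_, fun x hx => (hc x hx).1, Metric.isOpen_ball,
    Metric.mem_ball_self hr⟩, (hc c (Metric.mem_ball_self hr)).2⟩

theorem bddBelow_cost (hρ : 0 < ρ) (A : Set (Δ × ℝ)) :
    BddBelow (p.cost ρ '' p.relaxedFeasible ρ A) :=
  ⟨0, by rintro _ ⟨x, -, rfl⟩; exact cost_nonneg hρ x⟩

theorem mem_relaxedFeasible_of_nonpos (hρ : 0 < ρ) {A : Set (Δ × ℝ)} {x : Dec d} (hx : x ∈ p.Y)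
    (h : ∀ e ∈ A, p.h x e.1 ≤ 0) : x ∈ p.relaxedFeasible ρ A :=
  ⟨hx, fun e he => (h e he).trans_lt (by positivity)⟩

theorem relaxedFeasible_nonempty (hρ : 0 < ρ) {A : Set (Δ × ℝ)} (hA : A.Finite) :
    (p.relaxedFeasible ρ A).Nonempty := by
  obtain ⟨c, hc, hcA⟩ := p.exists_mem_interior_feasible hA
  exact ⟨c, mem_relaxedFeasible_of_nonpos hρ (interior_subset hc) hcA⟩

theorem value_le_cost (hρ : 0 < ρ) {A : Set (Δ × ℝ)} {x : Dec d}
    (hx : x ∈ p.relaxedFeasible ρ A) : p.value ρ A ≤ p.cost ρ x :=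
  csInf_le (bddBelow_cost hρ A) ⟨x, hx, rfl⟩

theorem value_lt_iff (hρ : 0 < ρ) {A : Set (Δ × ℝ)} (hA : A.Finite) {a : ℝ} :
    p.value ρ A < a ↔ ∃ x ∈ p.relaxedFeasible ρ A, p.cost ρ x < a := by
  unfold value
  rw [csInf_lt_iff (bddBelow_cost hρ A) ((relaxedFeasible_nonempty hρ hA).image _)]
  simp

theorem value_mono (hρ : 0 < ρ) {A B : Set (Δ × ℝ)} (hB : B.Finite) (h : A ⊆ B) :
    p.value ρ A ≤ p.value ρ B :=
  csInf_le_csInf (bddBelow_cost hρ A) ((relaxedFeasible_nonempty hρ hB).image _)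
    (Set.image_mono fun _ hx => ⟨hx.1, fun e he => hx.2 e (h he)⟩)

theorem exists_combination_lt {u w a : ℝ} (h : u < a) :
    ∃ l : ℝ, 0 < l ∧ l < 1 ∧ (1 - l) * u + l * w < a := by
  have h1 : Filter.Tendsto (fun l : ℝ => (1 - l) * u + l * w) (nhdsWithin 0 (Set.Ioi 0))
      (nhds u) := by
    have : Continuous fun l : ℝ => (1 - l) * u + l * w := by fun_prop
    have h2 := this.tendsto 0
    simp only [sub_zero, one_mul, zero_mul, add_zero] at h2
    exact h2.mono_left nhdsWithin_le_nhds
  obtain ⟨l, hl, hl'⟩ := ((h1.eventually (gt_mem_nhds h)).and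
    (Ioo_mem_nhdsGT (zero_lt_one (α := ℝ)))).exists
  exact ⟨l, hl'.1, hl'.2, hl⟩

/-- Minimizers need not exist, as nothing makes the domain closed. Near-minimizers of `A` and of
each `insert e A` are however close by strict convexity, and a slight contraction towards a Slater
ball makes a single point feasible for all of `S` at once. -/
theorem value_union_eq (hρ : 0 < ρ) {A S : Set (Δ × ℝ)} (hA : A.Finite) (hS : S.Finite)
    (h : ∀ e ∈ S, p.value ρ (insert e A) = p.value ρ A) :
    p.value ρ (A ∪ S) = p.value ρ A := by
  refine le_antisymm ?_ (value_mono hρ (hA.union hS) Set.subset_union_left)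
  by_contra! hlt
  obtain ⟨c, r, hr, hc⟩ := p.exists_ball_feasible (hA.union hS)
  obtain ⟨hcY, hcA⟩ := hc c (Metric.mem_ball_self hr)
  obtain ⟨l, hl0, hl1, hl⟩ := exists_combination_lt (w := p.cost ρ c) hlt
  set u := p.value ρ A with hu
  -- The first bound on `η` keeps the cost of `z` below the union's value; the second puts
  -- near-minimizers within distance `l * r`.
  obtain ⟨η, hη0, hη1, hη2⟩ : ∃ η : ℝ, 0 < η ∧
      (1 - l) * (u + η) + l * p.cost ρ c < p.value ρ (A ∪ S) ∧ η < ρ / 4 * (l * r) ^ 2 := by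
    refine ⟨min ((p.value ρ (A ∪ S) - ((1 - l) * u + l * p.cost ρ c)) / 2)
      (ρ / 4 * (l * r) ^ 2 / 2), ?_, ?_, ?_⟩
    · refine lt_min (by linarith) (by positivity)
    · have := min_le_left ((p.value ρ (A ∪ S) - ((1 - l) * u + l * p.cost ρ c)) / 2)
        (ρ / 4 * (l * r) ^ 2 / 2)
      set m := min ((p.value ρ (A ∪ S) - ((1 - l) * u + l * p.cost ρ c)) / 2)
        (ρ / 4 * (l * r) ^ 2 / 2)
      have hm : 0 < m := lt_min (by linarith) (by positivity)
      nlinarith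
    · refine (min_le_right _ _).trans_lt (half_lt_self (by positivity))
  obtain ⟨y₀, hy₀, hy₀c⟩ := (value_lt_iff hρ hA).1 (show p.value ρ A < u + η by linarith)
  set z := (1 - l) • y₀ + l • c with hz
  have h1l : 0 ≤ 1 - l := by linarith
  have h1l' : 0 < 1 - l := by linarith
  have hzY : z ∈ p.Y := p.convexOn_f.1 hy₀.1 hcY h1l hl0.le (by ring)
  have key : ∀ e : Δ × ℝ, ∀ y ∈ p.Y, ∀ c' ∈ p.Y, z = (1 - l) • y + l • c' →
      p.h y e.1 < ρ * Real.exp e.2 → p.h c' e.1 ≤ 0 → p.h z e.1 < ρ * Real.exp e.2 := by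
    intro e y hy c' hc' hzy hye hce
    have h1 := (p.convexOn_h e.1).2 hy hc' h1l hl0.le (by ring)
    rw [hzy]
    simp only [smul_eq_mul] at h1
    have hpos : 0 < ρ * Real.exp e.2 := by positivity
    nlinarith
  have hzfeas : z ∈ p.relaxedFeasible ρ (A ∪ S) := by
    refine ⟨hzY, ?_⟩
    rintro e (he | he)
    · exact key e y₀ hy₀.1 c hcY hz (hy₀.2 e he) (hcA e (Or.inl he))
    · obtain ⟨y, hy, hyc⟩ := (value_lt_iff hρ (hA.insert e)).1
        (show p.value ρ (insert e A) < u + η by rw [h e he]; linarith)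
      have hyA : y ∈ p.relaxedFeasible ρ A :=
        ⟨hy.1, fun e' he' => hy.2 e' (Set.mem_insert_of_mem _ he')⟩
      have hmid : (1 / 2 : ℝ) • y₀ + (1 / 2 : ℝ) • y ∈ p.relaxedFeasible ρ A := by
        refine ⟨p.convexOn_f.1 hy₀.1 hy.1 (by norm_num) (by norm_num) (by norm_num),
          fun e' he' => ?_⟩
        have h1 := (p.convexOn_h e'.1).2 hy₀.1 hy.1 (by norm_num : (0 : ℝ) ≤ 1 / 2)
          (by norm_num : (0 : ℝ) ≤ 1 / 2) (by norm_num)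
        have h2 := hy₀.2 e' he'
        have h3 := hyA.2 e' he'
        simp only [smul_eq_mul] at h1
        linarith
      have h1 := value_le_cost hρ hmid
      have h2 := cost_midpoint_le (p := p) (ρ := ρ) y₀ y hy₀.1 hy.1
      have h3 : ρ / 4 * ‖y₀ - y‖ ^ 2 < ρ / 4 * (l * r) ^ 2 := by linarith
      have h4 : ‖y₀ - y‖ < l * r :=
        lt_of_pow_lt_pow_left₀ 2 (by positivity) (lt_of_mul_lt_mul_left h3 (by positivity))
      -- Replacing `y₀` by `y` is compensated by moving the centre: `z = (1 - l) • y + l • c'`, with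
      -- `c'` still in the Slater ball.
      set c' := c + (l⁻¹ * (1 - l)) • (y₀ - y) with hc'
      have hc'b : c' ∈ Metric.ball c r := by
        rw [hc', mem_ball_iff_norm, add_sub_cancel_left, norm_smul, Real.norm_eq_abs,
          abs_of_pos (by positivity)]
        calc l⁻¹ * (1 - l) * ‖y₀ - y‖ ≤ l⁻¹ * 1 * ‖y₀ - y‖ := by gcongr; linarith
          _ < l⁻¹ * 1 * (l * r) := by gcongr
          _ = r := by field_simp
      obtain ⟨hc'Y, hc'A⟩ := hc c' hc'b
      refine key e y hy.1 c' hc'Y ?_ (hy.2 e (Set.mem_insert _ _)) (hc'A e (Or.inr he))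
      rw [hz, hc', smul_add, smul_smul, ← mul_assoc, mul_inv_cancel₀ hl0.ne', one_mul, smul_sub]
      abel
  have h1 := value_le_cost hρ hzfeas
  have h2 := (convexOn_cost (p := p) hρ).2 hy₀.1 hcY h1l hl0.le (by ring)
  simp only [smul_eq_mul] at h2
  rw [← hz] at h2
  nlinarith

/-- At most one label of a scenario makes it give a prescribed value without being redundant. -/
theorem value_eq_of_value_insert_eq (hρ : 0 < ρ) {A : Set (Δ × ℝ)} (hA : A.Finite) {δ : Δ}
    {t t' w : ℝ} (htt' : t < t') (ht : p.value ρ (insert (δ, t) A) = w)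
    (ht' : p.value ρ (insert (δ, t') A) = w) : p.value ρ A = w := by
  refine le_antisymm (ht ▸ value_mono hρ (hA.insert _) (Set.subset_insert _ _)) ?_
  by_contra! hlt
  obtain ⟨y, hy, hyw⟩ := (value_lt_iff hρ hA).1 hlt
  set T := ρ * Real.exp t with hT
  set T' := ρ * Real.exp t' with hT'
  have hTT' : T < T' := mul_lt_mul_of_pos_left (Real.exp_lt_exp.2 htt') hρ
  -- A point `y` cheaper than `w` must violate the looser constraint. Moving a near-optimal point
  -- for `t` towards `y` lowers its cost below `w`, and the gap between `T` and `T'` leaves room to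
  -- do so.
  have hs : T' ≤ p.h y δ := by
    by_contra! hs
    have : y ∈ p.relaxedFeasible ρ (insert (δ, t') A) := by
      refine ⟨hy.1, ?_⟩
      rintro e (rfl | he)
      · exact hs
      · exact hy.2 e he
    have := value_le_cost hρ this
    linarith
  set s := p.h y δ with hsdef
  have hsT : 0 < s - T := by linarith
  -- With this step length the constraint rises by at most half of `T' - T`.
  set l := (T' - T) / (2 * (s - T)) with hl
  have hl0 : 0 < l := div_pos (by linarith) (by linarith)
  have hl1 : l < 1 := by
    rw [hl, div_lt_one (by linarith)]
    linarith
  have hls : l * (s - T) = (T' - T) / 2 := by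
    rw [hl]; field_simp
  obtain ⟨x, hx, hxw⟩ := (value_lt_iff hρ (hA.insert (δ, t))).1
    (show p.value ρ (insert (δ, t) A) < w + l * (w - p.cost ρ y) by
      rw [ht]; nlinarith [mul_pos hl0 (sub_pos.2 hyw)])
  have h1l : 0 ≤ 1 - l := by linarith
  have hz : (1 - l) • x + l • y ∈ p.relaxedFeasible ρ (insert (δ, t') A) := by
    refine ⟨p.convexOn_f.1 hx.1 hy.1 h1l hl0.le (by ring), ?_⟩
    rintro e he
    have hc := (p.convexOn_h e.1).2 hx.1 hy.1 h1l hl0.le (by ring)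
    simp only [smul_eq_mul] at hc
    rcases he with rfl | he
    · have hxT : p.h x δ < T := hx.2 (δ, t) (Set.mem_insert _ _)
      refine hc.trans_lt ?_
      change (1 - l) * p.h x δ + l * s < T'
      nlinarith
    · have hx' := hx.2 e (Set.mem_insert_of_mem _ he)
      have hy' := hy.2 e he
      nlinarith
  have h1 := value_le_cost hρ hz
  have h2 := (convexOn_cost (p := p) hρ).2 hx.1 hy.1 h1l hl0.le (by ring)
  simp only [smul_eq_mul] at h2
  rw [ht'] at h1
  nlinarith [mul_pos hl0 (sub_pos.2 hyw)]

/-- Helly's theorem in `W`, for the projections of the constraint sets and of the set of points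
cheaper than the value of `A`. If no small basis existed, every `finrank W + 1` of these would meet,
hence all would; since constraints see only projections, some feasible point would beat the optimal
value. -/
theorem exists_basis (hρ : 0 < ρ) (V W : Submodule ℝ (Dec d))
    (hW : ∀ x ∈ p.Y, V.starProjection x ∈ W)
    (hdep : ∀ x ∈ p.Y, ∀ y ∈ p.Y, V.starProjection x = V.starProjection y →
      ∀ δ, p.h x δ = p.h y δ)
    {A : Set (Δ × ℝ)} (hA : A.Finite) :
    ∃ B ⊆ A, B.ncard ≤ Module.finrank ℝ W ∧ p.value ρ B = p.value ρ A := by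
  classical
  by_contra! hcon
  have hlt : ∀ B ⊆ A, B.ncard ≤ Module.finrank ℝ W → p.value ρ B < p.value ρ A :=
    fun B hB hk => lt_of_le_of_ne (value_mono hρ hA hB) (hcon B hB hk)
  let C : Option (Δ × ℝ) → Set (Dec d) := fun o => o.elim
    {x | x ∈ p.Y ∧ p.cost ρ x < p.value ρ A}
    (fun e => {x | x ∈ p.Y ∧ p.h x e.1 < ρ * Real.exp e.2})
  have hCY : ∀ o, C o ⊆ p.Y := by
    rintro (_ | e) x hx
    · exact hx.1
    · exact hx.1
  have hCconv : ∀ o, Convex ℝ (C o) := by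
    rintro (_ | e)
    · exact (convexOn_cost hρ).convex_lt _
    · exact (p.convexOn_h e.1).convex_lt _
  let F : Option (Δ × ℝ) → Set W := fun o => {w | ∃ x ∈ C o, V.starProjection x = w}
  have hF : ∀ o, Convex ℝ (F o) := by
    rintro o w ⟨x, hx, hxw⟩ w' ⟨x', hx', hxw'⟩ a b ha hb hab
    refine ⟨a • x + b • x', hCconv o hx hx' ha hb hab, ?_⟩
    simp [hxw, hxw']
  have hmem : ∀ x o, (hx : x ∈ C o) → (⟨V.starProjection x, hW x (hCY o hx)⟩ : W) ∈ F o :=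
    fun x o hx => ⟨x, hx, rfl⟩
  have hinter := Convex.helly_theorem' (𝕜 := ℝ) (F := F)
    (s := Finset.insertNone hA.toFinset) (fun o _ => hF o) (by
      intro I hI hcard
      have hsome : ∀ e, some e ∈ I → e ∈ A := by
        intro e he
        simpa using hI he
      by_cases hn : none ∈ I
      · have hBsub : {e | some e ∈ I} ⊆ A := fun e he => hsome e he
        have hBcard : {e | some e ∈ I}.ncard ≤ Module.finrank ℝ W := by
          have h1 : {e | some e ∈ I} = (Finset.eraseNone I : Set (Δ × ℝ)) := by
            ext e; simp
          rw [h1, Set.ncard_coe_finset]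
          have := Finset.card_eraseNone_eq_card_erase I
          rw [Finset.card_erase_of_mem hn] at this
          omega
        obtain ⟨x, hx, hxc⟩ := (value_lt_iff hρ (hA.subset hBsub)).1 (hlt _ hBsub hBcard)
        refine ⟨⟨V.starProjection x, hW x hx.1⟩, ?_⟩
        simp only [Set.mem_iInter]
        rintro (_ | e) ho
        · exact ⟨x, ⟨hx.1, hxc⟩, rfl⟩
        · exact ⟨x, ⟨hx.1, hx.2 e ho⟩, rfl⟩
      · obtain ⟨x, hx⟩ := p.relaxedFeasible_nonempty hρ hA
        refine ⟨⟨V.starProjection x, hW x hx.1⟩, ?_⟩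
        simp only [Set.mem_iInter]
        rintro (_ | e) ho
        · exact absurd ho hn
        · exact ⟨x, ⟨hx.1, hx.2 e (hsome e ho)⟩, rfl⟩)
  obtain ⟨w, hw⟩ := hinter
  simp only [Set.mem_iInter] at hw
  obtain ⟨x, hx, hxw⟩ := hw none (by simp)
  have hxA : x ∈ p.relaxedFeasible ρ A := by
    refine ⟨hx.1, fun e he => ?_⟩
    obtain ⟨y, hy, hyw⟩ := hw (some e) (by simpa using he)
    rw [hdep x hx.1 y hy.1 (hxw.trans hyw.symm)]
    exact hy.2
  exact absurd (value_le_cost hρ hxA) (not_le.2 hx.2)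

theorem isLPType_value (hρ : 0 < ρ) (V W : Submodule ℝ (Dec d))
    (hW : ∀ x ∈ p.Y, V.starProjection x ∈ W)
    (hdep : ∀ x ∈ p.Y, ∀ y ∈ p.Y, V.starProjection x = V.starProjection y →
      ∀ δ, p.h x δ = p.h y δ) : IsLPType (Module.finrank ℝ W) (p.value ρ) where
  mono _ _ hB h := value_mono hρ hB h
  basis _ hA := exists_basis hρ V W hW hdep hA
  locality _ _ hA hS h := value_union_eq hρ hA hS h

/-- Contraction towards a Slater point reaches the interior of the domain, where convex functions
are continuous. The strict inequalities then persist on a neighbourhood, which meets a dense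
sequence; this gives measurability of the value. -/
theorem value_lt_iff_denseSeq (hρ : 0 < ρ) {A : Set (Δ × ℝ)} (hA : A.Finite) {a : ℝ} :
    p.value ρ A < a ↔ ∃ m : ℕ, TopologicalSpace.denseSeq (Dec d) m ∈ p.relaxedFeasible ρ A ∧
      p.cost ρ (TopologicalSpace.denseSeq (Dec d) m) < a := by
  rw [value_lt_iff hρ hA]
  refine ⟨?_, fun ⟨m, hm⟩ => ⟨_, hm⟩⟩
  rintro ⟨x, hx, hxa⟩
  obtain ⟨c, hc, hcA⟩ := p.exists_mem_interior_feasible hA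
  obtain ⟨l, hl0, hl1, hl⟩ := exists_combination_lt (w := p.cost ρ c) hxa
  have h1l : 0 ≤ 1 - l := by linarith
  have h1l' : 0 < 1 - l := by linarith
  set z := (1 - l) • x + l • c with hz
  have hzY : z ∈ interior p.Y :=
    p.convexOn_f.1.combo_self_interior_mem_interior hx.1 hc h1l hl0 (by ring)
  have hcont : ∀ φ : Dec d → ℝ, ConvexOn ℝ p.Y φ → ContinuousAt φ z := fun φ hφ =>
    hφ.continuousOn_interior.continuousAt (isOpen_interior.mem_nhds hzY)
  have hcost : p.cost ρ z < a := by
    have := (convexOn_cost (p := p) hρ).2 hx.1 (interior_subset hc) h1l hl0.le (by ring)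
    simp only [smul_eq_mul] at this
    exact this.trans_lt hl
  have hh : ∀ e ∈ A, p.h z e.1 < ρ * Real.exp e.2 := by
    intro e he
    have h1 := (p.convexOn_h e.1).2 hx.1 (interior_subset hc) h1l hl0.le (by ring)
    simp only [smul_eq_mul] at h1
    have h2 := hx.2 e he
    have h3 := hcA e he
    have hpos : 0 < ρ * Real.exp e.2 := by positivity
    nlinarith
  have hev : ∀ᶠ q in nhds z, q ∈ interior p.Y ∧ p.cost ρ q < a ∧
      ∀ e ∈ A, p.h q e.1 < ρ * Real.exp e.2 := by
    refine (isOpen_interior.eventually_mem hzY).and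
      (((hcont _ (convexOn_cost hρ)).eventually (gt_mem_nhds hcost)).and ?_)
    rw [Filter.eventually_all_finite hA]
    exact fun e he => (hcont _ (p.convexOn_h e.1)).eventually (gt_mem_nhds (hh e he))
  obtain ⟨q, ⟨m, rfl⟩, hq⟩ := ((mem_closure_iff_frequently.1
    (TopologicalSpace.denseRange_denseSeq (Dec d) z)).and_eventually hev).exists
  exact ⟨m, ⟨interior_subset hq.1, hq.2.2⟩, hq.2.1⟩

theorem measurable_value [MeasurableSpace Δ] (hρ : 0 < ρ)
    (hmeas : ∀ x ∈ p.Y, Measurable (p.h x)) (n : ℕ) (I : Finset (Fin n)) :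
    Measurable fun ω : Fin n → Δ × ℝ => p.value ρ (ω '' I) := by
  refine measurable_of_Iio fun a => ?_
  have : (fun ω : Fin n → Δ × ℝ => p.value ρ (ω '' I)) ⁻¹' Set.Iio a =
      ⋃ m : ℕ, {ω | TopologicalSpace.denseSeq (Dec d) m ∈ p.relaxedFeasible ρ (ω '' I) ∧
        p.cost ρ (TopologicalSpace.denseSeq (Dec d) m) < a} := by
    ext ω
    simp only [Set.mem_preimage, Set.mem_Iio, Set.mem_iUnion]
    exact value_lt_iff_denseSeq hρ (Set.toFinite _)
  rw [this]
  refine MeasurableSet.iUnion fun m => ?_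
  set q := TopologicalSpace.denseSeq (Dec d) m
  by_cases hq : q ∈ p.Y ∧ p.cost ρ q < a
  · have : {ω : Fin n → Δ × ℝ | q ∈ p.relaxedFeasible ρ (ω '' I) ∧ p.cost ρ q < a} =
        ⋂ i ∈ I, {ω | p.h q (ω i).1 < ρ * Real.exp (ω i).2} := by
      ext ω
      simp only [relaxedFeasible, Set.mem_ofPred_eq, hq, true_and, and_true,
        Set.forall_mem_image, Set.mem_iInter, Finset.mem_coe]
    rw [this]
    refine Finset.measurableSet_biInter I fun i _ => measurableSet_lt ?_ ?_
    · exact (hmeas q hq.1).comp (measurable_fst.comp (measurable_pi_apply i))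
    · exact (Real.measurable_exp.comp (measurable_snd.comp (measurable_pi_apply i))).const_mul ρ
  · convert MeasurableSet.empty using 1
    ext ω
    simp only [Set.mem_empty_iff_false, iff_false]
    exact fun h => hq ⟨h.1.1, h.2⟩

/-! ### The limit of vanishing relaxation. -/

/-- The values of the relaxed programs converge to a limit that is not below the optimal value of
the original program. -/
theorem eventually_le_value {A : Set (Δ × ℝ)} (hA : A.Finite) {a m : ℝ} (ham : a < m)
    (hm : ∀ x ∈ p.Y, (∀ e ∈ A, p.h x e.1 ≤ 0) → m ≤ p.f x) :
    ∀ᶠ n : ℕ in Filter.atTop, a ≤ p.value (1 / ((n : ℝ) + 1)) A := by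
  by_contra hcon
  simp only [Filter.not_eventually, not_le] at hcon
  obtain ⟨φ, hφ, hlt⟩ := Filter.extraction_of_frequently_atTop hcon
  set r : ℕ → ℝ := fun n => 1 / ((φ n : ℝ) + 1) with hr
  have hr0 : ∀ n, 0 < r n := fun n => by positivity
  have hrlim : Filter.Tendsto r Filter.atTop (nhds 0) :=
    tendsto_one_div_add_atTop_nhds_zero_nat.comp hφ.tendsto_atTop
  choose x hx hxa using fun n => (value_lt_iff (hr0 n) hA).1 (hlt n)
  obtain ⟨x', hx', ψ, hψ, hlim⟩ := p.isBounded.isCompact_closure.tendsto_subseq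
    (x := x) (fun n => subset_closure (hx n).1)
  obtain ⟨c, hc, hcA⟩ := p.exists_mem_interior_feasible hA
  obtain ⟨l, hl0, hl1, hl⟩ := exists_combination_lt (w := p.f c) ham
  have h1l : 0 ≤ 1 - l := by linarith
  -- The limit `x'` lies only in the closure of the domain; contracting towards `c` restores
  -- membership and continuity.
  have hz : (1 - l) • x' + l • c ∈ interior p.Y := by
    have := p.convexOn_f.1.combo_closure_interior_mem_interior hx' hc h1l hl0 (by ring)
    exact this
  have hzlim : Filter.Tendsto (fun n => (1 - l) • x (ψ n) + l • c) Filter.atTop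
      (nhds ((1 - l) • x' + l • c)) := (hlim.const_smul _).add_const _
  have hcont : ∀ g : Dec d → ℝ, ConvexOn ℝ p.Y g → Filter.Tendsto
      (fun n => g ((1 - l) • x (ψ n) + l • c)) Filter.atTop
      (nhds (g ((1 - l) • x' + l • c))) := fun g hg =>
    (hg.continuousOn_interior.continuousAt (isOpen_interior.mem_nhds hz)).tendsto.comp hzlim
  have hzA : ∀ e ∈ A, p.h ((1 - l) • x' + l • c) e.1 ≤ 0 := by
    intro e he
    have hb : Filter.Tendsto (fun n => r (ψ n) * Real.exp e.2) Filter.atTop (nhds 0) := by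
      have := (hrlim.comp hψ.tendsto_atTop).mul_const (Real.exp e.2)
      rwa [zero_mul] at this
    refine le_of_tendsto_of_tendsto' (hcont _ (p.convexOn_h e.1)) hb fun n => ?_
    have h1 := (p.convexOn_h e.1).2 (hx (ψ n)).1 (interior_subset hc) h1l hl0.le (by ring)
    simp only [smul_eq_mul] at h1
    have h2 := (hx (ψ n)).2 e he
    have h3 := hcA e he
    have hpos : 0 < r (ψ n) * Real.exp e.2 := mul_pos (hr0 _) (Real.exp_pos _)
    change _ < r (ψ n) * Real.exp e.2 at h2
    nlinarith
  have hzf : p.f ((1 - l) • x' + l • c) ≤ (1 - l) * a + l * p.f c := by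
    refine le_of_tendsto' (hcont _ p.convexOn_f) fun n => ?_
    have h1 := p.convexOn_f.2 (hx (ψ n)).1 (interior_subset hc) h1l hl0.le (by ring)
    simp only [smul_eq_mul] at h1
    have h2 : p.f (x (ψ n)) ≤ a := by
      have h3 := hxa (ψ n)
      unfold cost at h3
      have : 0 ≤ r (ψ n) * ‖x (ψ n)‖ ^ 2 := mul_nonneg (hr0 _).le (by positivity)
      change p.f (x (ψ n)) + r (ψ n) * ‖x (ψ n)‖ ^ 2 < a at h3
      linarith
    nlinarith
  linarith [hm _ (interior_subset hz) hzA]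

theorem eventually_value_lt {A : Set (Δ × ℝ)} {x : Dec d} (hx : x ∈ p.Y)
    (hxA : ∀ e ∈ A, p.h x e.1 ≤ 0) {a : ℝ} (ha : p.f x < a) :
    ∀ᶠ n : ℕ in Filter.atTop, p.value (1 / ((n : ℝ) + 1)) A < a := by
  have : Filter.Tendsto (fun n : ℕ => p.f x + 1 / ((n : ℝ) + 1) * ‖x‖ ^ 2) Filter.atTop
      (nhds (p.f x)) := by
    simpa using (tendsto_one_div_add_atTop_nhds_zero_nat.mul_const (‖x‖ ^ 2)).const_add (p.f x)
  filter_upwards [this.eventually (gt_mem_nhds ha)] with n hn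
  have hpos : 0 < 1 / ((n : ℝ) + 1) := by positivity
  exact (value_le_cost hpos (mem_relaxedFeasible_of_nonpos hpos hx hxA)).trans_lt hn

end ConvexScenario

/-! ### Almost sure nondegeneracy and the bound for one constraint function. -/

theorem pi_measure_eq_zero_of_update {Ω : Type*} [MeasurableSpace Ω] (Q : Measure Ω)
    [IsProbabilityMeasure Q] {n : ℕ} {s : Set (Fin n → Ω)} (hs : MeasurableSet s) (j : Fin n)
    (h : ∀ ω, Q {x | Function.update ω j x ∈ s} = 0) :
    Measure.pi (fun _ : Fin n => Q) s = 0 := by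
  obtain ⟨x₀⟩ := nonempty_of_isProbabilityMeasure Q
  have hf : Measurable (s.indicator (1 : (Fin n → Ω) → ENNReal)) := measurable_one.indicator hs
  rw [← lintegral_indicator_one hs, lintegral_eq_lmarginal_univ fun _ => x₀,
    lmarginal_erase' _ hf (Finset.mem_univ j)]
  have : (fun x : Fin n → Ω => ∫⁻ xj, s.indicator (1 : (Fin n → Ω) → ENNReal)
      (Function.update x j xj) ∂Q) = 0 := by
    ext x
    have h1 : (fun xj => s.indicator (1 : (Fin n → Ω) → ENNReal) (Function.update x j xj)) =
        {y | Function.update x j y ∈ s}.indicator 1 := rfl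
    have hm : MeasurableSet {y | Function.update x j y ∈ s} := measurable_update x hs
    rw [h1]
    exact (lintegral_indicator_one hm).trans (h x)
  rw [this]
  simp [lmarginal]

/-- Continuity from below along the increasing sets of points that stay in `s n` from some index on;
no measurability is needed. -/
theorem eventually_lt_measure {α : Type*} [MeasurableSpace α] (μ : Measure α) {S : Set α}
    {s : ℕ → Set α} (h : ∀ x ∈ S, ∀ᶠ n in Filter.atTop, x ∈ s n) {c : ENNReal} (hc : c < μ S) :
    ∀ᶠ n in Filter.atTop, c < μ (s n) := by
  set t : ℕ → Set α := fun m => {x | ∀ n, m ≤ n → x ∈ s n} with ht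
  have htm : Monotone t := fun m m' hm x hx n hn => hx n (hm.trans hn)
  have hS : S ⊆ ⋃ m, t m := by
    intro x hx
    obtain ⟨m, hm⟩ := Filter.eventually_atTop.1 (h x hx)
    exact Set.mem_iUnion.2 ⟨m, hm⟩
  have hlt := hc.trans_le (measure_mono hS)
  rw [htm.measure_iUnion] at hlt
  obtain ⟨m, hm⟩ := lt_iSup_iff.1 hlt
  filter_upwards [Filter.eventually_ge_atTop m] with n hn
  exact hm.trans_le (measure_mono fun x hx => hx n hn)

namespace ConvexScenario

variable {d : ℕ} {Δ : Type*} [MeasurableSpace Δ] {p : ConvexScenario d Δ} {ρ : ℝ}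

/-- Independent labels without atoms make the relaxed program almost surely nondegenerate. -/
theorem ae_nondegenerate (hρ : 0 < ρ) (hmeas : ∀ x ∈ p.Y, Measurable (p.h x))
    (P : Measure Δ) [IsProbabilityMeasure P] (μ : Measure ℝ) [IsProbabilityMeasure μ] [NullSingletonClass μ]
    (n : ℕ) :
    ∀ᵐ ω ∂(Measure.pi fun _ : Fin n => P.prod μ), Nondegenerate (p.value ρ) Prod.snd ω := by
  have hslice : ∀ {s : Set (Fin n → Δ × ℝ)}, MeasurableSet s → ∀ j : Fin n,
      (∀ ω δ t t', t < t' → Function.update ω j (δ, t) ∈ s →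
        Function.update ω j (δ, t') ∈ s → False) →
      Measure.pi (fun _ : Fin n => P.prod μ) s = 0 := by
    intro s hs j h
    refine pi_measure_eq_zero_of_update _ hs j fun ω => ?_
    have hm : MeasurableSet {x | Function.update ω j x ∈ s} := measurable_update ω hs
    rw [Measure.measure_prod_null hm]
    refine Filter.Eventually.of_forall fun δ => Set.Subsingleton.measure_zero ?_ μ
    intro t ht t' ht'
    rcases lt_trichotomy t t' with hlt | heq | hlt
    · exact (h ω δ t t' hlt ht ht').elim
    · exact heq
    · exact (h ω δ t' t hlt ht' ht).elim
  have hinj : ∀ᵐ ω ∂(Measure.pi fun _ : Fin n => P.prod μ), ∀ i j : Fin n, i ≠ j →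
      (ω i).2 ≠ (ω j).2 := by
    refine ae_all_iff.2 fun i => ae_all_iff.2 fun j => ?_
    by_cases hij : i = j
    · exact Filter.Eventually.of_forall fun ω h => absurd hij h
    have hs : MeasurableSet {ω : Fin n → Δ × ℝ | (ω i).2 = (ω j).2} :=
      measurableSet_eq_fun (measurable_snd.comp (measurable_pi_apply i))
        (measurable_snd.comp (measurable_pi_apply j))
    have h0 := hslice hs j (by
      intro ω δ t t' hlt ht ht'
      simp only [Set.mem_ofPred_eq, Function.update_self, Function.update_of_ne hij] at ht ht'
      exact hlt.ne (ht.symm.trans ht'))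
    filter_upwards [measure_eq_zero_iff_ae_notMem.1 h0] with ω hω _
    exact hω
  have hbases : ∀ᵐ ω ∂(Measure.pi fun _ : Fin n => P.prod μ), ∀ B₁ B₂ : Finset (Fin n),
      ∀ j, j ∈ B₁ → j ∉ B₂ → p.value ρ (ω '' B₁) = p.value ρ (ω '' B₂) →
        p.value ρ (ω '' (B₁.erase j)) = p.value ρ (ω '' B₁) := by
    refine ae_all_iff.2 fun B₁ => ae_all_iff.2 fun B₂ => ae_all_iff.2 fun j => ?_
    by_cases hj : j ∈ B₁ ∧ j ∉ B₂
    swap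
    · exact Filter.Eventually.of_forall fun ω h1 h2 => absurd ⟨h1, h2⟩ hj
    have hv := fun I => measurable_value (p := p) hρ hmeas n I
    have hs : MeasurableSet {ω : Fin n → Δ × ℝ | p.value ρ (ω '' B₁) = p.value ρ (ω '' B₂) ∧
        p.value ρ (ω '' (B₁.erase j : Finset (Fin n))) ≠ p.value ρ (ω '' B₁)} :=
      (measurableSet_eq_fun (hv _) (hv _)).inter (measurableSet_eq_fun (hv _) (hv _)).compl
    -- With everything but the label of `j` fixed, the value on `B₂` is a constant, and at most one
    -- label can match it irredundantly.
    have h0 := hslice hs j (by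
      intro ω δ t t' hlt ht ht'
      have hu : ∀ (x : Δ × ℝ) (I : Finset (Fin n)), j ∉ I →
          Function.update ω j x '' (I : Set (Fin n)) = ω '' I := by
        intro x I hI
        refine Set.image_congr fun i hi => Function.update_of_ne ?_ _ _
        rintro rfl
        exact hI hi
      have hu1 : ∀ x : Δ × ℝ, Function.update ω j x '' (B₁ : Set (Fin n)) =
          insert x (ω '' (B₁.erase j : Finset (Fin n))) := by
        intro x
        rw [← hu x _ (Finset.notMem_erase j B₁)]
        conv_lhs => rw [← Finset.insert_erase hj.1, Finset.coe_insert, Set.image_insert_eq,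
          Function.update_self]
      simp only [Set.mem_ofPred_eq, hu1, hu _ _ hj.2, hu _ _ (Finset.notMem_erase j B₁)] at ht ht'
      exact ht.2 ((value_eq_of_value_insert_eq hρ (Set.toFinite _) hlt ht.1 ht'.1).trans
        ht.1.symm))
    filter_upwards [measure_eq_zero_iff_ae_notMem.1 h0] with ω hω _ _ heq
    by_contra hne
    exact hω ⟨heq, hne⟩
  filter_upwards [hinj, hbases] with ω h1 h2
  refine ⟨fun i j hij => ?_, fun B₁ B₂ j hj1 hj2 => h2 B₁ B₂ j hj1 hj2⟩
  by_contra hne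
  exact h1 i j hne hij

/-- The binomial bound on the violation probability of the minimizer of a scenario program with
one constraint function. -/
theorem measure_violation_le (hmeas : ∀ x ∈ p.Y, Measurable (p.h x))
    (P : Measure Δ) [IsProbabilityMeasure P] (V W : Submodule ℝ (Dec d))
    (hW : ∀ x ∈ p.Y, V.starProjection x ∈ W)
    (hdep : ∀ x ∈ p.Y, ∀ y ∈ p.Y, V.starProjection x = V.starProjection y →
      ∀ δ, p.h x δ = p.h y δ)
    (hWpos : 0 < Module.finrank ℝ W) {N : ℕ} (hN : Module.finrank ℝ W ≤ N)
    {ε : ℝ} (h0 : 0 ≤ ε) (h1 : ε ≤ 1) (x : (Fin N → Δ) → Dec d)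
    (hxY : ∀ ω, x ω ∈ p.Y) (hxω : ∀ ω i, p.h (x ω) (ω i) ≤ 0)
    (hstrict : ∀ ω δ, 0 < p.h (x ω) δ → ∃ m, p.f (x ω) < m ∧
      ∀ y ∈ p.Y, (∀ i, p.h y (ω i) ≤ 0) → p.h y δ ≤ 0 → m ≤ p.f y) :
    Measure.pi (fun _ : Fin N => P) {ω | ENNReal.ofReal ε < P {δ | 0 < p.h (x ω) δ}} ≤
      ENNReal.ofReal (binomialTail N ε (Module.finrank ℝ W)) := by
  obtain ⟨k, hk⟩ := Nat.exists_eq_succ_of_ne_zero hWpos.ne'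
  set μ : Measure ℝ := volume.restrict (Set.Icc 0 1) with hμ
  have : IsProbabilityMeasure μ := ⟨by simp [hμ]⟩
  set Q := P.prod μ with hQ
  set S : Set (Fin N → Δ) := {ω | ENNReal.ofReal ε < P {δ | 0 < p.h (x ω) δ}} with hS
  have hSQ : Measure.pi (fun _ : Fin N => P) S =
      Measure.pi (fun _ : Fin N => Q) {ω | (fun i => (ω i).1) ∈ S} := by
    have hmp := measurePreserving_arrowProdEquivProdArrow Δ ℝ (Fin N) (fun _ => P) (fun _ => μ)
    have := hmp.measure_preimage_equiv (S ×ˢ Set.univ)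
    rw [Measure.prod_prod, measure_univ, mul_one] at this
    rw [← this]
    congr 1
    ext ω
    simp [MeasurableEquiv.arrowProdEquivProdArrow, Equiv.arrowProdEquivProdArrow]
  set r : ℕ → ℝ := fun n => 1 / ((n : ℝ) + 1) with hr
  have hr0 : ∀ n, 0 < r n := fun n => by positivity
  set E : ℕ → Set (Fin N → Δ × ℝ) := fun n => {ω | ENNReal.ofReal ε <
    Q {e | p.value (r n) (Set.range ω) < p.value (r n) (insert e (Set.range ω))}} with hE
  have hEle : ∀ n, Measure.pi (fun _ : Fin N => Q) (E n) ≤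
      ENNReal.ofReal (binomialTail N ε (Module.finrank ℝ W)) := by
    intro n
    have hlp := isLPType_value (p := p) (hr0 n) V W hW hdep
    rw [hk] at hlp hN ⊢
    exact hlp.measure_violation_le Q measurable_snd
      (fun n' I => measurable_value (hr0 n) hmeas n' I)
      (fun n' => ae_nondegenerate (hr0 n) hmeas P μ n') hN h0 h1
  rw [hSQ]
  by_contra! hlt
  -- Lower continuity is used twice: over samples here, and below over the new scenario `e` for a
  -- fixed sample.
  suffices h : ∀ ω ∈ {ω : Fin N → Δ × ℝ | (fun i => (ω i).1) ∈ S},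
      ∀ᶠ n in Filter.atTop, ω ∈ E n by
    obtain ⟨n, hn⟩ := (eventually_lt_measure _ h hlt).exists
    exact absurd (hEle n) (not_le.2 hn)
  intro ω hω
  have hω' : ENNReal.ofReal ε < P {δ | 0 < p.h (x fun i => (ω i).1) δ} := hω
  set x₀ := x fun i => (ω i).1 with hx₀
  have hPQ : P {δ | 0 < p.h x₀ δ} = Q {e | 0 < p.h x₀ e.1} := by
    have := Measure.prod_prod (μ := P) (ν := μ) {δ | 0 < p.h x₀ δ} Set.univ
    rw [measure_univ, mul_one] at this
    rw [← this]
    congr 1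
    ext e
    simp
  rw [hPQ] at hω'
  refine eventually_lt_measure Q (fun e he => ?_) hω'
  obtain ⟨m, hm, hmle⟩ := hstrict (fun i => (ω i).1) e.1 he
  have h2 : ∀ᶠ n : ℕ in Filter.atTop, p.value (r n) (Set.range ω) < (p.f x₀ + m) / 2 :=
    eventually_value_lt (hxY _) (by
      rintro _ ⟨i, rfl⟩
      exact hxω (fun i => (ω i).1) i) (by rw [← hx₀] at hm; linarith)
  have h3 : ∀ᶠ n : ℕ in Filter.atTop,
      (p.f x₀ + m) / 2 ≤ p.value (r n) (insert e (Set.range ω)) :=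
    eventually_le_value ((Set.finite_range ω).insert e) (m := m)
      (by rw [← hx₀] at hm; linarith) fun y hy hyA =>
        hmle y hy (fun i => hyA _ (Set.mem_insert_of_mem _ ⟨i, rfl⟩)) (hyA _ (Set.mem_insert _ _))
  filter_upwards [h2, h3] with n h2 h3
  exact h2.trans_le h3

end ConvexScenario

/-! ### Several constraints: conditioning on the samples of the others. -/

theorem FeasibleUnique.of_finite {d M : ℕ} {Δ : Type*} {X : Set (Dec d)} {f : Dec d → ℝ}
    {g : Fin M → Dec d → Δ → ℝ} (h : FeasibleUnique X f g) {D : Fin M → Set Δ}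
    (hD : ∀ l, (D l).Finite) (hne : ∃ l, (D l).Nonempty) :
    (interior (feasibleSet X g D)).Nonempty ∧ ∃! x, IsMinimizer X f g D x := by
  have hfin : (⋃ l, D l).Finite := Set.finite_iUnion hD
  obtain ⟨l₀, δ₀, hδ₀⟩ := hne
  have hpos : 0 < hfin.toFinset.card :=
    Finset.card_pos.2 ⟨δ₀, hfin.mem_toFinset.2 (Set.mem_iUnion.2 ⟨l₀, hδ₀⟩)⟩
  let e := hfin.toFinset.equivFin
  refine (h _ hpos (fun j => (e.symm j : Δ)) D (fun l δ hδ => ?_) fun j => ?_).2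
  · have hmem : δ ∈ hfin.toFinset := hfin.mem_toFinset.2 (Set.mem_iUnion.2 ⟨l, hδ⟩)
    exact ⟨e ⟨δ, hmem⟩, by simp⟩
  · exact Set.mem_iUnion.1 (hfin.mem_toFinset.1 (e.symm j).2)

/-- Finite sets that cover a finite type and have the right total cardinality are disjoint. -/
theorem eq_of_mem_of_sum_card {ι κ : Type*} [Fintype ι] [Fintype κ] [DecidableEq ι]
    {J : κ → Finset ι} (hcover : ∀ j, ∃ i, j ∈ J i) (hcard : ∑ i, (J i).card = Fintype.card ι)
    {j : ι} {i l : κ} (hi : j ∈ J i) (hl : j ∈ J l) : i = l := by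
  classical
  have h1 : ∑ i, (J i).card = ∑ j, (Finset.univ.filter fun i => j ∈ J i).card := by
    simp_rw [Finset.card_eq_sum_ones, Finset.sum_filter]
    rw [Finset.sum_comm]
    refine Finset.sum_congr rfl fun i _ => ?_
    rw [← Finset.sum_filter]
    simp
  have h2 : ∀ j ∈ (Finset.univ : Finset ι), 1 ≤ (Finset.univ.filter fun i => j ∈ J i).card := by
    intro j _
    obtain ⟨i, hi⟩ := hcover j
    exact Finset.card_pos.2 ⟨i, by simpa using hi⟩
  -- Every point is covered at least once and the multiplicities sum to the number of points, so
  -- each is exactly one.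
  have h3 := (Finset.sum_eq_sum_iff_of_le h2).1 (by rw [← h1, hcard]; simp) j (Finset.mem_univ j)
  exact Finset.card_le_one.1 h3.ge i (by simpa using hi) l (by simpa using hl)

section MultipleConstraints

variable {d M : ℕ} {Δ : Type*} {X : Set (Dec d)} {f : Dec d → ℝ} {g : Fin M → Dec d → Δ → ℝ}

theorem convex_feasible_of_ne (hX : Convex ℝ X) (hg : ∀ i δ, ConvexOn ℝ X fun x => g i x δ)
    (i : Fin M) (D : Fin M → Set Δ) :
    Convex ℝ {x | x ∈ X ∧ ∀ l, l ≠ i → ∀ δ ∈ D l, g l x δ ≤ 0} := by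
  intro x hx y hy a b ha hb hab
  refine ⟨hX hx.1 hy.1 ha hb hab, fun l hl δ hδ => ?_⟩
  exact ((hg l δ).convex_le 0 ⟨hx.1, hx.2 l hl δ hδ⟩ ⟨hy.1, hy.2 l hl δ hδ⟩ ha hb hab).2

/-- The program in which only the scenarios of the `i`-th constraint vary, while those of the
other constraints are fixed finite sets. The objective is made nonnegative. -/
noncomputable def singleConstraint [Nonempty Δ] (hX : IsCompact X) (hf : ConvexOn ℝ X f)
    (hg : ∀ i δ, ConvexOn ℝ X fun x => g i x δ) (h : FeasibleUnique X f g) (i : Fin M)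
    (D : Fin M → Set Δ) (hD : ∀ l, (D l).Finite) : ConvexScenario d Δ where
  Y := {x | x ∈ X ∧ ∀ l, l ≠ i → ∀ δ ∈ D l, g l x δ ≤ 0}
  f x := Real.exp (f x)
  h := g i
  convexOn_f := by
    have hexp : ConvexOn ℝ X fun x => Real.exp (f x) :=
      ⟨hf.1, fun x hx y hy a b ha hb hab =>
        (Real.exp_le_exp.2 (hf.2 hx hy ha hb hab)).trans
          (convexOn_exp.2 (Set.mem_univ _) (Set.mem_univ _) ha hb hab)⟩
    exact hexp.subset (fun x hx => hx.1) (convex_feasible_of_ne hf.1 hg i D)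
  convexOn_h δ := (hg i δ).subset (fun x hx => hx.1) (convex_feasible_of_ne hf.1 hg i D)
  f_nonneg _ := (Real.exp_pos _).le
  isBounded := hX.isBounded.subset fun _ hx => hx.1
  slater := by
    classical
    intro E hE
    obtain ⟨δ₀⟩ := ‹Nonempty Δ›
    -- The extra scenario `δ₀` is needed because the standing assumption says nothing about an empty
    -- set of scenarios.
    have hfin : ∀ l, (Function.update D i (insert δ₀ E) l).Finite := by
      intro l
      by_cases hl : l = i
      · subst hl
        rw [Function.update_self]
        exact hE.insert δ₀
      · rw [Function.update_of_ne hl]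
        exact hD l
    refine (h.of_finite hfin ⟨i, δ₀, by simp⟩).1.mono (interior_mono fun x hx => ?_)
    refine ⟨⟨hx.1, fun l hl δ hδ => hx.2 l δ (by rwa [Function.update_of_ne hl])⟩,
      fun δ hδ => hx.2 i δ ?_⟩
    rw [Function.update_self]
    exact Set.mem_insert_of_mem _ hδ

/-- Adding a scenario that the minimizer violates increases the optimal value. -/
theorem FeasibleUnique.exists_gt_of_violation (h : FeasibleUnique X f g) {D : Fin M → Set Δ}
    (hD : ∀ l, (D l).Finite) (hne : ∃ l, (D l).Nonempty) {x : Dec d}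
    (hx : IsMinimizer X f g D x) {i : Fin M} {δ : Δ} (hδ : 0 < g i x δ) :
    ∃ m, f x < m ∧ ∀ y ∈ feasibleSet X g D, g i y δ ≤ 0 → m ≤ f y := by
  classical
  have hfin : ∀ l, (Function.update D i (insert δ (D i)) l).Finite := by
    intro l
    by_cases hl : l = i
    · subst hl
      rw [Function.update_self]
      exact (hD l).insert δ
    · rw [Function.update_of_ne hl]
      exact hD l
  have hmem : ∀ y, y ∈ feasibleSet X g (Function.update D i (insert δ (D i))) ↔
      y ∈ feasibleSet X g D ∧ g i y δ ≤ 0 := by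
    intro y
    constructor
    · intro hy
      refine ⟨⟨hy.1, fun l δ' hδ' => hy.2 l δ' ?_⟩, hy.2 i δ (by simp)⟩
      by_cases hl : l = i
      · subst hl
        rw [Function.update_self]
        exact Set.mem_insert_of_mem _ hδ'
      · rwa [Function.update_of_ne hl]
    · rintro ⟨hy, hyδ⟩
      refine ⟨hy.1, fun l δ' hδ' => ?_⟩
      by_cases hl : l = i
      · subst hl
        rw [Function.update_self] at hδ'
        rcases hδ' with rfl | hδ'
        · exact hyδ
        · exact hy.2 l δ' hδ'
      · rw [Function.update_of_ne hl] at hδ'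
        exact hy.2 l δ' hδ'
  obtain ⟨x', hx', -⟩ := (h.of_finite hfin ⟨i, δ, by simp⟩).2
  obtain ⟨hx'D, hx'δ⟩ := (hmem x').1 hx'.1
  -- The bound is the new optimal value. Were it equal to `f x`, then `x'` would also minimize the
  -- old program, and uniqueness would make `x` satisfy the violated constraint.
  refine ⟨f x', lt_of_le_of_ne (hx.2 x' hx'D) fun heq => ?_,
    fun y hy hyδ => hx'.2 y ((hmem y).2 ⟨hy, hyδ⟩)⟩
  have hx'min : IsMinimizer X f g D x' := ⟨hx'D, fun y hy => heq ▸ hx.2 y hy⟩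
  have := (h.of_finite hD hne).2.unique hx hx'min
  rw [this] at hδ
  exact absurd hx'δ (not_le.2 hδ)

variable [MeasurableSpace Δ]

theorem measurableSet_violation (P : Measure Δ) [SFinite P] {Ω : Type*} [MeasurableSpace Ω]
    {h : Dec d → Δ → ℝ} (hh : Measurable fun q : X × Δ => h (q.1 : Dec d) q.2)
    {x : Ω → Dec d} (hx : Measurable x) (hxX : ∀ ω, x ω ∈ X) (c : ENNReal) :
    MeasurableSet {ω | c < P {δ | 0 < h (x ω) δ}} := by
  have h1 : Measurable fun q : Ω × Δ => h (x q.1) q.2 := by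
    have h2 : Measurable fun q : Ω × Δ => ((⟨x q.1, hxX q.1⟩ : X), q.2) :=
      ((hx.comp measurable_fst).subtype_mk).prodMk measurable_snd
    exact hh.comp h2
  have h3 : MeasurableSet {q : Ω × Δ | 0 < h (x q.1) q.2} :=
    measurableSet_lt measurable_const h1
  exact measurableSet_lt measurable_const (measurable_measure_prodMk_left h3)

/-- The violation probability of a single constraint of a scenario program with multiple
constraints. -/
theorem measure_single_violation_le (P : Measure Δ) [IsProbabilityMeasure P]
    (hX : IsCompact X) (hf : ConvexOn ℝ X f)
    (hg : ∀ i δ, ConvexOn ℝ X fun x => g i x δ)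
    (hgm : ∀ i, Measurable fun q : X × Δ => g i (q.1 : Dec d) q.2)
    (h : FeasibleUnique X f g) {i : Fin M} {V : Submodule ℝ (Dec d)}
    (hV : DependsOnlyOn X V (g i)) {ε β : ℝ} (hε : ε ∈ Set.Ioo (0 : ℝ) 1)
    (hβ : β ∈ Set.Ioo (0 : ℝ) 1) {N T : ℕ}
    (hN : sampleSize ε β (setDim (constraintDomain X V)) ≤ N) {J : Fin M → Finset (Fin T)}
    (hJ : (J i).card = N) (hdisj : ∀ j l, j ∈ J i → j ∈ J l → i = l)
    {x : (Fin T → Δ) → Dec d} (hx : Measurable x)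
    (hmin : ∀ ω : Fin T → Δ,
      IsMinimizer X f g (fun i => ω '' (J i : Set (Fin T))) (x ω)) :
    Measure.pi (fun _ : Fin T => P) {ω | ENNReal.ofReal ε < P {δ | 0 < g i (x ω) δ}} ≤
      ENNReal.ofReal β := by
  classical
  have hΔ : Nonempty Δ := nonempty_of_isProbabilityMeasure P
  have hxX : ∀ ω, x ω ∈ X := fun ω => (hmin ω).1.1
  set W := Submodule.span ℝ (constraintDomain X V) with hW
  have hXW : ∀ y ∈ X, V.starProjection y ∈ W := fun y hy =>
    Submodule.subset_span ⟨y, hy, rfl⟩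
  -- In dimension zero `g i` is constant in `x` on `X`, and feasibility makes it nonpositive, so it
  -- is never violated.
  rcases Nat.eq_zero_or_pos (Module.finrank ℝ W) with hzero | hpos
  · have hWbot : W = ⊥ := Submodule.finrank_eq_zero.1 hzero
    have hproj : ∀ y ∈ X, V.starProjection y = 0 := fun y hy => by
      have := hXW y hy
      rwa [hWbot, Submodule.mem_bot] at this
    have hnon : ∀ y ∈ X, ∀ δ, g i y δ ≤ 0 := by
      intro y hy δ
      obtain ⟨z, hz⟩ := (h.of_finite (D := fun _ => {δ}) (fun _ => Set.finite_singleton δ)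
        ⟨i, δ, rfl⟩).1
      have hz' := interior_subset hz
      rw [hV y hy z hz'.1 ((hproj y hy).trans (hproj z hz'.1).symm) δ]
      exact hz'.2 i δ rfl
    have hempty : {ω | ENNReal.ofReal ε < P {δ | 0 < g i (x ω) δ}} = ∅ := by
      ext ω
      have : {δ | 0 < g i (x ω) δ} = ∅ := by
        ext δ
        simpa using hnon _ (hxX ω) δ
      simp [this]
    rw [hempty, measure_empty]
    exact zero_le
  have htail : binomialTail N ε (Module.finrank ℝ W) ≤ β :=
    binomialTail_le_of_sampleSize_le hε hβ.1 hN
  have hkN : Module.finrank ℝ W ≤ N := le_of_binomialTail_lt_one (htail.trans_lt hβ.2)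
  have hbad := measurableSet_violation P (hgm i) hx hxX (ENNReal.ofReal ε)
  obtain ⟨Φ, hΦ, hinl, hinr⟩ := exists_splitEquiv P (J i) hJ
  rw [← hΦ.measure_preimage_equiv, Measure.prod_apply_symm (Φ.measurable hbad)]
  -- Fubini: with the samples `z` outside `J i` fixed, the other constraints have fixed scenario
  -- sets `D l`, by disjointness.
  have hslice : ∀ z : {j // j ∉ J i} → Δ, Measure.pi (fun _ : Fin N => P)
      ((fun w => (w, z)) ⁻¹' (Φ ⁻¹' {ω | ENNReal.ofReal ε < P {δ | 0 < g i (x ω) δ}})) ≤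
        ENNReal.ofReal β := by
    intro z
    let D : Fin M → Set Δ := fun l => {δ | ∃ j : {j // j ∉ J i}, (j : Fin T) ∈ J l ∧ z j = δ}
    have hD : ∀ l, (D l).Finite := fun l =>
      (Set.finite_range z).subset (by rintro δ ⟨j, -, rfl⟩; exact ⟨j, rfl⟩)
    let p := singleConstraint hX hf hg h i D hD
    have himg : ∀ w, Φ (w, z) '' (J i : Set (Fin T)) = Set.range w := by
      intro w
      ext δ
      constructor
      · rintro ⟨j, hj, rfl⟩
        refine ⟨((J i).orderIsoOfFin hJ).symm ⟨j, hj⟩, ?_⟩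
        have := hinl (w, z) (((J i).orderIsoOfFin hJ).symm ⟨j, hj⟩)
        rw [OrderIso.apply_symm_apply] at this
        exact this.symm
      · rintro ⟨k, rfl⟩
        exact ⟨_, ((J i).orderIsoOfFin hJ k).2, hinl (w, z) k⟩
    have himg' : ∀ w l, l ≠ i → Φ (w, z) '' (J l : Set (Fin T)) = D l := by
      intro w l hl
      ext δ
      constructor
      · rintro ⟨j, hj, rfl⟩
        have hji : j ∉ J i := fun hji => hl (hdisj j l hji hj).symm
        exact ⟨⟨j, hji⟩, hj, (hinr (w, z) ⟨j, hji⟩).symm⟩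
      · rintro ⟨j, hj, rfl⟩
        exact ⟨j, hj, hinr (w, z) j⟩
    have hfeas : ∀ w y, y ∈ feasibleSet X g (fun l => Φ (w, z) '' (J l : Set (Fin T))) ↔
        y ∈ p.Y ∧ ∀ k, g i y (w k) ≤ 0 := by
      intro w y
      constructor
      · intro hy
        refine ⟨⟨hy.1, fun l hl δ hδ => hy.2 l δ ?_⟩, fun k => hy.2 i _ ?_⟩
        · change δ ∈ Φ (w, z) '' (J l : Set (Fin T))
          rwa [himg' w l hl]
        · change w k ∈ Φ (w, z) '' (J i : Set (Fin T))
          rw [himg w]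
          exact ⟨k, rfl⟩
      · rintro ⟨hy, hyw⟩
        refine ⟨hy.1, fun l δ hδ => ?_⟩
        change δ ∈ Φ (w, z) '' (J l : Set (Fin T)) at hδ
        by_cases hl : l = i
        · subst hl
          rw [himg w] at hδ
          obtain ⟨k, rfl⟩ := hδ
          exact hyw k
        · rw [himg' w l hl] at hδ
          exact hy.2 l hl δ hδ
    have hne : (J i).Nonempty := Finset.card_pos.1 (by omega)
    have hbound := ConvexScenario.measure_violation_le (p := p)
      (fun y hy => (hgm i).comp (measurable_prodMk_left (x := (⟨y, hy.1⟩ : X)))) P V W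
      (fun y hy => hXW y hy.1) (fun y hy y' hy' => hV y hy.1 y' hy'.1) hpos hkN hε.1.le hε.2.le
      (fun w => x (Φ (w, z))) (fun w => ((hfeas w _).1 (hmin _).1).1)
      (fun w => ((hfeas w _).1 (hmin _).1).2) (by
        intro w δ hδ
        obtain ⟨m, hm, hmle⟩ := h.exists_gt_of_violation (fun l => Set.toFinite _)
          ⟨i, hne.to_set.image _⟩ (hmin (Φ (w, z))) hδ
        -- The exponential made the objective nonnegative; being strictly increasing, it also
        -- preserves the strict gap.
        exact ⟨Real.exp m, Real.exp_lt_exp.2 hm, fun y hy hyw hyδ =>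
          Real.exp_le_exp.2 (hmle y ((hfeas w y).2 ⟨hy, hyw⟩) hyδ)⟩)
    exact hbound.trans (ENNReal.ofReal_le_ofReal htail)
  calc _ ≤ ∫⁻ _, ENNReal.ofReal β ∂(Measure.pi fun _ : {j // j ∉ J i} => P) :=
        lintegral_mono hslice
    _ = ENNReal.ofReal β := by simp

end MultipleConstraints

end ScenarioProgram

/-! ### The joint guarantee by two union bounds. -/

theorem mainTheorem2 {d M : ℕ} [NeZero M]
    {Δ : Type*} [MeasurableSpace Δ] (P : MeasureTheory.Measure Δ)
    [MeasureTheory.IsProbabilityMeasure P]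
    (X : Set (ScenarioProgram.Dec d)) (hXcompact : IsCompact X) (hXconvex : Convex ℝ X)
    (f : ScenarioProgram.Dec d → ℝ) (hf : ConvexOn ℝ X f)
    (g : Fin M → ScenarioProgram.Dec d → Δ → ℝ)
    (hgconvex : ∀ i δ, ConvexOn ℝ X (fun x => g i x δ))
    (hgmeas : ∀ i, Measurable (fun p : X × Δ => g i (p.1 : ScenarioProgram.Dec d) p.2))
    (hassum : ScenarioProgram.FeasibleUnique X f g)
    -- the i-th constraint involves only the part of the decision vector in `V i`
    (V : Fin M → Submodule ℝ (ScenarioProgram.Dec d))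
    (hV : ∀ i, ScenarioProgram.DependsOnlyOn X (V i) (g i))
    -- violation and confidence levels
    (ε β : ℝ) (hε : ε ∈ Set.Ioo (0 : ℝ) 1) (hβ : β ∈ Set.Ioo (0 : ℝ) 1)
    (εs βs : Fin M → ℝ) (hεs : ∀ i, εs i ∈ Set.Ioo (0 : ℝ) 1)
    (hβs : ∀ i, βs i ∈ Set.Ioo (0 : ℝ) 1)
    (hεsum : ∑ i, εs i = ε) (hβsum : ∑ i, βs i = β)
    -- sample sizes, and the assignment of the `∑ i, S i` samples to the constraints
    (S : Fin M → ℕ)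
    (hS : ∀ i, ScenarioProgram.sampleSize (εs i) (βs i)
      (ScenarioProgram.setDim (ScenarioProgram.constraintDomain X (V i))) ≤ S i)
    (J : Fin M → Finset (Fin (∑ i, S i)))
    (hJcard : ∀ i, (J i).card = S i) (hJcover : ∀ j, ∃ i, j ∈ J i)
    -- the minimizer of the scenario program, as a measurable function of the samples
    (xstar : (Fin (∑ i, S i) → Δ) → ScenarioProgram.Dec d) (hxmeas : Measurable xstar)
    (hxmin : ∀ ω : Fin (∑ i, S i) → Δ,
      ScenarioProgram.IsMinimizer X f g (fun i => ω '' (J i : Set (Fin (∑ i, S i)))) (xstar ω)) :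
    ENNReal.ofReal (1 - β) ≤
      MeasureTheory.Measure.pi (fun _ : Fin (∑ i, S i) => P)
        {ω | ScenarioProgram.ChanceConstraint P (ScenarioProgram.jointConstraint g) ε
          (xstar ω)} := by
  classical
  have hbad : ∀ i, MeasureTheory.Measure.pi (fun _ : Fin (∑ i, S i) => P)
      {ω | ENNReal.ofReal (εs i) < P {δ | 0 < g i (xstar ω) δ}} ≤ ENNReal.ofReal (βs i) :=
    fun i => ScenarioProgram.measure_single_violation_le P hXcompact hf hgconvex hgmeas hassum
      (hV i) (hεs i) (hβs i) (hS i) (hJcard i)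
      (fun j l hi hl => ScenarioProgram.eq_of_mem_of_sum_card hJcover
        (by simp [hJcard]) hi hl) hxmeas hxmin
  have hmeas : ∀ i, MeasurableSet
      {ω : Fin (∑ i, S i) → Δ | ENNReal.ofReal (εs i) < P {δ | 0 < g i (xstar ω) δ}} :=
    fun i => ScenarioProgram.measurableSet_violation P (hgmeas i) hxmeas
      (fun ω => (hxmin ω).1.1) _
  have hunion : MeasureTheory.Measure.pi (fun _ : Fin (∑ i, S i) => P)
      (⋃ i, {ω | ENNReal.ofReal (εs i) < P {δ | 0 < g i (xstar ω) δ}}) ≤ ENNReal.ofReal β := by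
    refine (MeasureTheory.measure_iUnion_fintype_le _ _).trans ?_
    rw [← hβsum, ENNReal.ofReal_sum_of_nonneg fun i _ => (hβs i).1.le]
    exact Finset.sum_le_sum fun i _ => hbad i
  -- Outside the bad events, a second union bound, over `δ`, adds the levels `εs i` up to `ε`.
  have hsub : (⋃ i, {ω | ENNReal.ofReal (εs i) < P {δ | 0 < g i (xstar ω) δ}})ᶜ ⊆
      {ω | ScenarioProgram.ChanceConstraint P (ScenarioProgram.jointConstraint g) ε
        (xstar ω)} := by
    intro ω hω
    simp only [Set.mem_compl_iff, Set.mem_iUnion, Set.mem_ofPred_eq, not_exists, not_lt] at hω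
    have hset : {δ | 0 < ScenarioProgram.jointConstraint g (xstar ω) δ} =
        ⋃ i, {δ | 0 < g i (xstar ω) δ} := by
      ext δ
      simp [ScenarioProgram.jointConstraint, Finset.lt_sup'_iff]
    change P {δ | 0 < ScenarioProgram.jointConstraint g (xstar ω) δ} ≤ ENNReal.ofReal ε
    rw [hset, ← hεsum, ENNReal.ofReal_sum_of_nonneg fun i _ => (hεs i).1.le]
    exact (MeasureTheory.measure_iUnion_fintype_le _ _).trans
      (Finset.sum_le_sum fun i _ => hω i)
  refine le_trans ?_ (MeasureTheory.measure_mono hsub)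
  rw [MeasureTheory.prob_compl_eq_one_sub (MeasurableSet.iUnion hmeas),
    ENNReal.ofReal_sub _ hβ.1.le, ENNReal.ofReal_one]
  exact tsub_le_tsub_left hunion 1
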